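/- Let $M\subset\mathbb{C}=\mathbb{R}^2$ be a compact domain with piecewise smooth boundary, i.e. $M$ is compact, it is the closure of its nonempty connected interior $\operatorname{int}(M)$, and away from finitely many points $\partial M$ is locally a smooth curve with $M$ on one side of it. Let $V:(0,\infty)\to\mathbb{R}$ be smooth and strictly convex, with $V(1)=0$ and $V(x)>0$ for $x\neq 1$, and with $V'(x)\sqrt{x}$ bounded near $x=0$; then $V$ extends continuously to $[0,\infty)$, and $V(0)$ denotes the value of this extension. With $f_z=\frac12(f_x-if_y)$ and $f_{\bar z}=\frac12(f_x+if_y)$ put $$E_V(f)=\frac12\int_M V(|f_z|^2)+|f_{\bar z}|^2 .$$ A map $f:M\to\mathbb{R}^2$ is *almost smooth* if it is Lipschitz and smooth away from finitely many points. It is *almost immersed* if it is Lipschitz and its regular part $\operatorname{reg}(f)$, the set of points of $M$ at which $f$ is smooth and $f_z\neq0$, has finite complement in $M$. An almost immersed map $f$ is a *weak critical point* of $E_V$ if $\frac{d}{dt}\big|_{t=0}E_V(f+th)=0$ for all smooth $h$ compactly supported in $\operatorname{reg}(f)\cap\operatorname{int}(M)$. An almost smooth map $f$ is a *minimizer with fixed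 boundary* if $E_V(f)\le E_V(\tilde f)$ for all almost smooth $\tilde f$ with $\tilde f|_{\partial M}=f|_{\partial M}$, and a *strict minimizer* if $E_V(f)<E_V(\tilde f)$ for all such $\tilde f\neq f$. It is *locally unstable* if there is $p\in\operatorname{int}(M)$ such that for every neighbourhood $U$ of $p$ there is a smooth $h$ compactly supported in $U\cap\operatorname{int}(M)$ with $E_V(f+th)<E_V(f)$ for all sufficiently small $t>0$. Let $f:M\to\mathbb{R}^2$ be almost smooth, and consider the condition $$1+V'(|f_z|^2)\ \ge\ 0\quad\text{on }\operatorname{reg}(f)\cap\operatorname{int}(M).\tag{S}$$ 1. Suppose that $f$ is almost immersed or that $1+V'(x)<0$ for some $x>0$. Then $f$ is a minimizer for $E_V$ with fixed boundary if and only if $f$ is a weak critical point of $E_V$ and (S) holds. 2. If $f$ is a weak critical point of $E_V$, (S) holds, and $1+V'(|f_z|^2)$ does not vanish identically on $\operatorname{reg}(f)\cap\operatorname{int}(M)$, then $f$ is a strict minimizer. 3. If $f$ is a weak critical point of $E_V$ but not a minimizer, then $f$ is locally unstable. Moreover there is then $p\in\operatorname{int}(M)$ such that for every neighbourhood $U$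 of $p$ there is a smooth $h$ compactly supported in $U\cap\operatorname{reg}(f)\cap\operatorname{int}(M)$ for which $\frac{d^2}{dt^2}\big|_{t=0}E_V(f+th)$ exists and is negative. -/

import Mathlib

open scoped ContDiff Topology

noncomputable section

namespace PlanarElasticity

/-- A compact planar domain with piecewise smooth boundary: a compact set which is the closure of
its nonempty connected interior and whose boundary is, away from finitely many points (the
corners), locally a smooth curve with the set on one side of it.
No condition is imposed at the corners. -/
structure IsPiecewiseSmoothDomain (M : Set ℂ) : Prop where
  isCompact : IsCompact M
  isConnected_interior : IsConnected (interior M)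
  closure_interior : closure (interior M) = M
  smooth_boundary : ∃ C : Set ℂ, C.Finite ∧ ∀ p ∈ frontier M \ C,
    ∃ (W : Set ℂ) (ρ : ℂ → ℝ), IsOpen W ∧ p ∈ W ∧ ContDiffOn ℝ ∞ ρ W ∧ fderiv ℝ ρ p ≠ 0 ∧
      ∀ z ∈ W, (z ∈ M ↔ ρ z ≤ 0)

/-- The conditions on the function `V : (0, ∞) → ℝ`: it is smooth, strictly convex, has its only
minimum, of value zero, at `1`, and `V'(x) √x` is bounded near `0`. The last condition makes `V`
extend continuously to `[0, ∞)`; `V 0` denotes the value of that extension. -/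
structure IsAdmissible (V : ℝ → ℝ) : Prop where
  smooth : ContDiffOn ℝ ∞ V (Set.Ioi 0)
  strictConvexOn : StrictConvexOn ℝ (Set.Ioi 0) V
  map_one : V 1 = 0
  pos_of_ne_one : ∀ x : ℝ, 0 < x → x ≠ 1 → 0 < V x
  deriv_mul_sqrt_bounded : (fun x : ℝ => deriv V x * √x) =O[𝓝[>] 0] (fun _ => (1 : ℝ))
  tendsto_zero : Filter.Tendsto V (𝓝[>] 0) (𝓝 (V 0))

/-- The Wirtinger derivative `f_z = (f_x - i f_y) / 2` of a map `f` on `M`. -/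
def dz (M : Set ℂ) (f : ℂ → ℂ) (z : ℂ) : ℂ :=
  (fderivWithin ℝ f M z 1 - Complex.I * fderivWithin ℝ f M z Complex.I) / 2

/-- The Wirtinger derivative `f_z̄ = (f_x + i f_y) / 2` of a map `f` on `M`. -/
def dzbar (M : Set ℂ) (f : ℂ → ℂ) (z : ℂ) : ℂ :=
  (fderivWithin ℝ f M z 1 + Complex.I * fderivWithin ℝ f M z Complex.I) / 2

/-- The energy `E_V(f) = 1/2 ∫_M V(|f_z|²) + |f_z̄|²`. (The boundary of `M` is a null set, so the
integral is taken over the interior.) -/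
def energy (V : ℝ → ℝ) (M : Set ℂ) (f : ℂ → ℂ) : ℝ :=
  1 / 2 * ∫ z in interior M, (V (‖dz M f z‖ ^ 2) + ‖dzbar M f z‖ ^ 2)

/-- `f : M → ℝ²` is almost smooth: Lipschitz, and smooth away from finitely many points. Only the
values of `f` on `M` matter. -/
def AlmostSmooth (M : Set ℂ) (f : ℂ → ℂ) : Prop :=
  (∃ K, LipschitzOnWith K f M) ∧ ∃ P : Set ℂ, P.Finite ∧ ContDiffOn ℝ ∞ f (M \ P)

/-- The regular part of `f`: the points of `M` at which `f` is smooth and `f_z` does not vanish. -/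
def reg (M : Set ℂ) (f : ℂ → ℂ) : Set ℂ :=
  {z | z ∈ M ∧ ContDiffWithinAt ℝ ∞ f M z ∧ dz M f z ≠ 0}

/-- `f : M → ℝ²` is almost immersed: Lipschitz and, on the complement of finitely many points,
smooth with nonvanishing `f_z`. -/
def AlmostImmersed (M : Set ℂ) (f : ℂ → ℂ) : Prop :=
  (∃ K, LipschitzOnWith K f M) ∧ (M \ reg M f).Finite

/-- `h` is a smooth variation compactly supported in `U`. -/
def IsVariation (U : Set ℂ) (h : ℂ → ℂ) : Prop :=
  ContDiff ℝ ∞ h ∧ HasCompactSupport h ∧ tsupport h ⊆ U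

/-- The energy `t ↦ E_V(f + t h)` along the variation `h`. -/
def energyAlong (V : ℝ → ℝ) (M : Set ℂ) (f h : ℂ → ℂ) (t : ℝ) : ℝ :=
  energy V M (fun z => f z + (t : ℂ) * h z)

/-- `f` is a weak critical point of `E_V`: it is almost immersed, and the first variation of `E_V`
vanishes for all smooth variations compactly supported in `reg(f) ∩ int(M)`. -/
def IsWeakCriticalPoint (V : ℝ → ℝ) (M : Set ℂ) (f : ℂ → ℂ) : Prop :=
  AlmostImmersed M f ∧
    ∀ h : ℂ → ℂ, IsVariation (reg M f ∩ interior M) h → HasDerivAt (energyAlong V M f h) 0 0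

/-- The condition `1 + V'(|f_z|²) ≥ 0`, on `reg(f) ∩ int(M)`. -/
def IsStable (V : ℝ → ℝ) (M : Set ℂ) (f : ℂ → ℂ) : Prop :=
  ∀ z ∈ reg M f ∩ interior M, 0 ≤ 1 + deriv V (‖dz M f z‖ ^ 2)

/-- `f` is a minimizer with fixed boundary for `E_V`. -/
def IsMinimizer (V : ℝ → ℝ) (M : Set ℂ) (f : ℂ → ℂ) : Prop :=
  AlmostSmooth M f ∧ ∀ f' : ℂ → ℂ, AlmostSmooth M f' → Set.EqOn f' f (frontier M) →
    energy V M f ≤ energy V M f'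

/-- `f` is a strict minimizer with fixed boundary for `E_V`. -/
def IsStrictMinimizer (V : ℝ → ℝ) (M : Set ℂ) (f : ℂ → ℂ) : Prop :=
  AlmostSmooth M f ∧ ∀ f' : ℂ → ℂ, AlmostSmooth M f' → Set.EqOn f' f (frontier M) →
    ¬ Set.EqOn f' f M → energy V M f < energy V M f'

/-- `f` is locally unstable for `E_V`: there is an interior point `p` such that every neighbourhood
of `p` supports a variation of `f` that brings down the energy. -/
def IsLocallyUnstable (V : ℝ → ℝ) (M : Set ℂ) (f : ℂ → ℂ) : Prop :=
  AlmostSmooth M f ∧ ∃ p ∈ interior M, ∀ U ∈ 𝓝 p, ∃ h : ℂ → ℂ, IsVariation (U ∩ interior M) h ∧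
    ∀ᶠ t in 𝓝[>] (0 : ℝ), energyAlong V M f h t < energy V M f

/-- There is an interior point `p` such that every neighbourhood of `p` supports a variation `h`
of `f`, away from the singular points of `f`, along which the second variation
`d²/dt² E_V(f + t h)` at `t = 0` exists and is negative. -/
def HasLocallyNegativeSecondVariation (V : ℝ → ℝ) (M : Set ℂ) (f : ℂ → ℂ) : Prop :=
  ∃ p ∈ interior M, ∀ U ∈ 𝓝 p, ∃ h : ℂ → ℂ, IsVariation (U ∩ (reg M f ∩ interior M)) h ∧
    ∃ (E' : ℝ → ℝ) (c : ℝ), (∀ᶠ t in 𝓝 (0 : ℝ), HasDerivAt (energyAlong V M f h) (E' t) t) ∧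
      HasDerivAt E' c 0 ∧ c < 0

end PlanarElasticity

end

open PlanarElasticity

open scoped ContDiff Topology

noncomputable section

/-! Since `|f_z|² - |f_z̄|²` is the Jacobian determinant, the energy is half the integral of
`P(f_z)`, where `P(w) = V(|w|²) + |w|²`, minus half the integral of the Jacobian. The Jacobian is a
null Lagrangian for Lipschitz maps (`integral_jacobian_eq`), so among maps with given boundary
values only the integral of `P(f_z)` counts (`energy_sub_energy`).

The first variation pairs `h_z` with the momentum `φ = (1 + V'(|f_z|²)) f_z`. Criticality therefore
means `φ_z̄ = 0` on the regular part. As `V'(x)√x` is bounded near `0`, `φ` is bounded, so its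
finitely many singularities are removable and it extends to a holomorphic `Φ` on the interior,
orthogonal to `H_z` for every Lipschitz `H` vanishing off the interior
(`integral_re_conj_mul_wirt_eq_zero`). Convexity of `V` bounds `P(w)` below by its first-order
expansion at `w₀` plus `(1 + V'(|w₀|²)) |w - w₀|²` (`potential_ge`). With `H = f' - f` the linear
term integrates to zero, and twice the energy excess is at least the integral of `(1 + V'(|f_z|²))
|H_z|²`. Under (S) this gives minimality. If moreover `Φ` is not identically zero, its zeros form a
null set because the interior is connected, so equality forces `H_z = 0` almost everywhere; the null
Lagrangian then gives `H_z̄ = 0`, and `H = 0`.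

Where `1 + V'(|f_z|²) < 0`, the potential `P` is strictly concave at `f_z` in the direction `i f_z`,
tangent to the circle through `f_z`. Variations oscillating rapidly with `h_z` close to a real
multiple of this direction have negative second variation (`exists_variation_neg`). Hence minimizers
satisfy (S), and weak critical points violating (S) are locally unstable.

It remains to see that minimizers are almost immersed if `V'(x) < -1` for some `x > 0`. By (S) and
monotonicity of `V'`, at smooth interior points either `f_z = 0` or `|f_z|² ≥ x`, so zeros of `f_z`
fill open sets. There a small bump lowers the energy, because `P(w) < P(0)` for `0 < |w|² ≤ x`. The
lower bound on `|f_z|²` then passes to the boundary by continuity, away from corners and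
singularities. -/

namespace PlanarElasticity

open MeasureTheory Set Filter Metric
open scoped NNReal ComplexConjugate

/-! ### Directional derivatives of Lipschitz functions under the integral -/

section Lipschitz

variable {E : Type*} [NormedAddCommGroup E] [NormedSpace ℝ E] [FiniteDimensional ℝ E]
  [MeasurableSpace E] [BorelSpace E] {μ : Measure E} [μ.IsAddHaarMeasure]

/-- The difference quotients of a compactly supported Lipschitz function converge to its
directional derivative, tested against a locally integrable function. -/
theorem tendsto_integral_slope_mul_of_locallyIntegrable {g a : E → ℝ} {D : ℝ≥0}
    (hg : LipschitzWith D g) (h'g : HasCompactSupport g) (ha : LocallyIntegrable a μ) (v : E) :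
    Tendsto (fun t : ℝ => ∫ x, (t⁻¹ • (g (x + t • v) - g x)) * a x ∂μ) (𝓝[>] 0)
      (𝓝 (∫ x, lineDeriv ℝ g x v * a x ∂μ)) := by
  -- This compact set contains the supports of all translates `g(· + t v)` with `0 < t ≤ 1`, so
  -- replacing `a` by its restriction to `K` changes no integral and makes it integrable.
  set K := cthickening ‖v‖ (tsupport g) with hK
  have K_compact : IsCompact K := IsCompact.cthickening h'g
  have hsub : tsupport g ⊆ K := self_subset_cthickening _
  have key := hg.integral_inv_smul_sub_mul_tendsto_integral_lineDeriv_mul (μ := μ)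
    (g := K.indicator a) ((ha.integrableOn_isCompact K_compact).integrable_indicator
      K_compact.measurableSet) v
  have e1 : ∫ x, lineDeriv ℝ g x v * K.indicator a x ∂μ = ∫ x, lineDeriv ℝ g x v * a x ∂μ := by
    refine integral_congr_ae (Eventually.of_forall fun x => ?_)
    by_cases hx : x ∈ K
    · simp [hx]
    · have : lineDeriv ℝ g x v = 0 := by
        have h0 : g =ᶠ[𝓝 x] fun _ => 0 := notMem_tsupport_iff_eventuallyEq.1 fun h => hx (hsub h)
        rw [h0.lineDeriv_eq]
        simp [lineDeriv]
      simp [this]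
  rw [e1] at key
  refine key.congr' ?_
  filter_upwards [Ioc_mem_nhdsGT (zero_lt_one' ℝ)] with t ht
  refine integral_congr_ae (Eventually.of_forall fun x => ?_)
  by_cases hx : x ∈ K
  · simp [hx]
  · have h1 : g x = 0 := image_eq_zero_of_notMem_tsupport fun h => hx (hsub h)
    have h2 : g (x + t • v) = 0 := by
      refine image_eq_zero_of_notMem_tsupport fun h => hx ?_
      refine mem_cthickening_of_dist_le x (x + t • v) _ _ h ?_
      rw [dist_self_add_right, norm_smul, Real.norm_of_nonneg ht.1.le]
      exact mul_le_of_le_one_left (norm_nonneg _) ht.2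
    simp [h1, h2]

theorem integrable_lineDeriv_of_hasCompactSupport {g : E → ℝ} {D : ℝ≥0}
    (hg : LipschitzWith D g) (h'g : HasCompactSupport g) (w : E) :
    Integrable (fun x => lineDeriv ℝ g x w) μ := by
  refine (integrableOn_iff_integrable_of_support_subset (s := tsupport g) ?_).1
    ((hg.locallyIntegrable_lineDeriv w).integrableOn_isCompact h'g)
  intro x hx
  by_contra h
  have h0 : g =ᶠ[𝓝 x] fun _ => 0 := notMem_tsupport_iff_eventuallyEq.1 h
  refine hx (h0.lineDeriv_eq.trans ?_)
  simp [lineDeriv]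

theorem integrable_lineDeriv_mul_lineDeriv {f g : E → ℝ} {C D : ℝ≥0}
    (hf : LipschitzWith C f) (hg : LipschitzWith D g) (h'g : HasCompactSupport g) (v w : E) :
    Integrable (fun x => lineDeriv ℝ f x v * lineDeriv ℝ g x w) μ :=
  (integrable_lineDeriv_of_hasCompactSupport hg h'g w).bdd_mul
    (aestronglyMeasurable_lineDeriv hf.continuous μ)
    (Eventually.of_forall fun _ => norm_lineDeriv_le_of_lipschitz ℝ hf)

/-- Mixed directional derivatives may be exchanged under the integral. -/
theorem integral_lineDeriv_mul_lineDeriv_comm {f g : E → ℝ} {C D : ℝ≥0}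
    (hf : LipschitzWith C f) (hg : LipschitzWith D g) (h'g : HasCompactSupport g) (v w : E) :
    ∫ x, lineDeriv ℝ f x v * lineDeriv ℝ g x w ∂μ =
      ∫ x, lineDeriv ℝ f x w * lineDeriv ℝ g x v ∂μ := by
  have hgw := integrable_lineDeriv_of_hasCompactSupport (μ := μ) hg h'g w
  -- Both sides are limits of difference quotients, of `f` in `A` and of `g` in `B`. For fixed `t >
  -- 0` the two integrals agree: integrate by parts in the direction `w`, then move the translation
  -- by `t v` from `f` to `g`. No second derivative is needed.
  have A := hf.integral_inv_smul_sub_mul_tendsto_integral_lineDeriv_mul hgw v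
  have B := tendsto_integral_slope_mul_of_locallyIntegrable hg h'g
    (hf.locallyIntegrable_lineDeriv (μ := μ) (-w)) (-v)
  have e : ∫ x, lineDeriv ℝ g x (-v) * lineDeriv ℝ f x (-w) ∂μ =
      ∫ x, lineDeriv ℝ f x w * lineDeriv ℝ g x v ∂μ := by
    simp only [lineDeriv_neg]
    exact integral_congr_ae (Eventually.of_forall fun x => by simp [mul_comm])
  rw [e] at B
  refine tendsto_nhds_unique A (B.congr' ?_)
  filter_upwards [self_mem_nhdsWithin] with t (ht : 0 < t)
  have hshift : LipschitzWith C (fun x => f (x + t • v)) := fun x y => by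
    simpa using hf (x + t • v) (y + t • v)
  have hF : LipschitzWith (‖t⁻¹‖₊ * (C + C)) (fun x => t⁻¹ • (f (x + t • v) - f x)) :=
    (lipschitzWith_smul t⁻¹).comp (hshift.sub hf)
  have h1 := hF.integral_lineDeriv_mul_eq (μ := μ) hg h'g (-w)
  rw [neg_neg] at h1
  have h2 : ∫ x, (t⁻¹ • (f (x + t • v) - f x)) * lineDeriv ℝ g x w ∂μ =
      ∫ x, (t⁻¹ • (lineDeriv ℝ f (x + t • v) (-w) - lineDeriv ℝ f x (-w))) * g x ∂μ := by
    rw [integral_congr_ae (Eventually.of_forall fun x => mul_comm _ _), ← h1]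
    have hd := hf.ae_lineDifferentiableAt (μ := μ) (-w)
    have hd' : ∀ᵐ x ∂μ, LineDifferentiableAt ℝ f (x + t • v) (-w) :=
      (quasiMeasurePreserving_add_right μ (t • v)).ae hd
    refine integral_congr_ae ?_
    filter_upwards [hd, hd'] with x hx hx'
    congr 1
    have h3 : HasLineDerivAt ℝ (fun y => f (y + t • v)) (lineDeriv ℝ f (x + t • v) (-w)) x (-w) := by
      have := hx'.hasLineDerivAt
      simp only [HasLineDerivAt] at this ⊢
      convert this using 3
      abel
    have h4 : HasLineDerivAt ℝ (fun y => t⁻¹ • (f (y + t • v) - f y))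
        (t⁻¹ • (lineDeriv ℝ f (x + t • v) (-w) - lineDeriv ℝ f x (-w))) x (-w) := by
      have := hx.hasLineDerivAt
      simp only [HasLineDerivAt] at this h3 ⊢
      exact (h3.sub this).const_smul t⁻¹
    exact h4.lineDeriv
  rw [h2]
  have hi : ∀ u : E, Integrable (fun x => lineDeriv ℝ f x (-w) * g (x + u)) μ := by
    intro u
    have hc : HasCompactSupport (fun x => g (x + u)) :=
      h'g.comp_homeomorph (Homeomorph.addRight u)
    have := (hf.locallyIntegrable_lineDeriv (μ := μ) (-w)).integrable_smul_left_of_hasCompactSupport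
      (hg.continuous.comp (continuous_add_const u)) hc
    simpa [mul_comm] using this
  have hi1 : Integrable (fun x => lineDeriv ℝ f (x + t • v) (-w) * g x) μ := by
    have := (hi (-(t • v))).comp_add_right (t • v)
    simpa using this
  have h5 : ∫ x, lineDeriv ℝ f (x + t • v) (-w) * g x ∂μ =
      ∫ x, lineDeriv ℝ f x (-w) * g (x + t • -v) ∂μ := by
    rw [← integral_add_right_eq_self (μ := μ) (fun x => lineDeriv ℝ f x (-w) * g (x + t • -v))
      (t • v)]
    simp
  have hi2 : Integrable (fun x => lineDeriv ℝ f x (-w) * g x) μ := by simpa using hi 0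
  have h6 : ∀ x, t⁻¹ • (lineDeriv ℝ f (x + t • v) (-w) - lineDeriv ℝ f x (-w)) * g x =
      t⁻¹ * (lineDeriv ℝ f (x + t • v) (-w) * g x - lineDeriv ℝ f x (-w) * g x) := by
    intro x; simp only [smul_eq_mul]; ring
  have h7 : ∀ x, t⁻¹ • (g (x + t • -v) - g x) * lineDeriv ℝ f x (-w) =
      t⁻¹ * (lineDeriv ℝ f x (-w) * g (x + t • -v) - lineDeriv ℝ f x (-w) * g x) := by
    intro x; simp only [smul_eq_mul]; ring
  simp only [h6, h7]
  rw [integral_const_mul, integral_const_mul, integral_sub hi1 hi2, integral_sub (hi _) hi2, h5]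

/-- The derivative of a Lipschitz self-map of `E` vanishes almost everywhere on its zero set. -/
theorem ae_fderiv_eq_zero_of_eq_zero {H : E → E} {C : ℝ≥0} (hH : LipschitzWith C H) :
    ∀ᵐ x ∂μ, H x = 0 → fderiv ℝ H x = 0 := by
  have hm : MeasurableSet {x | H x = 0} := hH.continuous.measurable (measurableSet_singleton 0)
  have hd : MeasurableSet {x | DifferentiableAt ℝ H x} := measurableSet_of_differentiableAt ℝ H
  -- On its zero set `H` is approximated by the linear map `0` with constant `0`; a density-point
  -- argument then bounds the distance from the derivative to `0` by that constant almost
  -- everywhere.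
  have happ : ApproximatesLinearOn H (0 : E →L[ℝ] E)
      ({x | H x = 0} ∩ {x | DifferentiableAt ℝ H x}) 0 := by
    intro x hx y hy
    have h1 : H x = 0 := hx.1
    have h2 : H y = 0 := hy.1
    simp [h1, h2]
  have h := happ.norm_fderiv_sub_le μ (hm.inter hd) (fderiv ℝ H)
    fun x hx => hx.2.hasFDerivAt.hasFDerivWithinAt
  rw [ae_restrict_iff' (hm.inter hd)] at h
  filter_upwards [h, hH.ae_differentiableAt (μ := μ)] with x hx hdx h0
  have := hx ⟨h0, hdx⟩
  rw [sub_zero] at this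
  exact nnnorm_eq_zero.1 (le_antisymm this bot_le)

end Lipschitz

/-- A Lipschitz function on `M` vanishing on the frontier of `M` is Lipschitz when extended by
zero. -/
theorem lipschitzWith_indicator {E : Type*} [NormedAddCommGroup E] [NormedSpace ℝ E]
    {F : Type*} [NormedAddCommGroup F] {M : Set E} {h : E → F}
    {C : ℝ≥0} (hM : IsClosed M) (hh : LipschitzOnWith C h M) (h0 : ∀ x ∈ frontier M, h x = 0) :
    LipschitzWith C (M.indicator h) := by
  have key : ∀ x ∈ M, ∀ y ∉ M, ‖h x‖ ≤ C * dist x y := by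
    intro x hx y hy
    -- A segment leaving `M` crosses the frontier, where `h` vanishes.
    obtain ⟨w, hw, hwf⟩ : ∃ w ∈ segment ℝ x y, w ∈ frontier M := by
      obtain ⟨w, hw, hwM⟩ := isPreconnected_closed_iff.1 (convex_segment x y).isPreconnected M
        (closure Mᶜ) hM isClosed_closure
        (fun z _ => (em (z ∈ M)).imp id fun h => subset_closure h)
        ⟨x, left_mem_segment ℝ x y, hx⟩ ⟨y, right_mem_segment ℝ x y, subset_closure hy⟩
      refine ⟨w, hw, ?_⟩
      rwa [frontier_eq_closure_inter_closure, hM.closure_eq]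
    have h1 := hh.dist_le_mul x hx w (hM.frontier_subset hwf)
    rw [h0 w hwf, dist_zero_right] at h1
    refine h1.trans (mul_le_mul_of_nonneg_left ?_ C.2)
    have := dist_add_dist_of_mem_segment hw
    linarith [dist_nonneg (x := w) (y := y)]
  refine LipschitzWith.of_dist_le_mul fun x y => ?_
  by_cases hx : x ∈ M <;> by_cases hy : y ∈ M
  · simpa [hx, hy] using hh.dist_le_mul x hx y hy
  · simpa [hx, hy] using key x hx y hy
  · rw [dist_comm x y, dist_comm]
    simpa [hx, hy] using key y hy x hx
  · simp [hx, hy]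
    positivity

/-! ### Wirtinger derivatives -/

/-- The Wirtinger derivative `∂f/∂z` of a map on the plane. -/
def wirt (f : ℂ → ℂ) (z : ℂ) : ℂ := (fderiv ℝ f z 1 - Complex.I * fderiv ℝ f z Complex.I) / 2

/-- The Wirtinger derivative `∂f/∂z̄` of a map on the plane. -/
def wirtBar (f : ℂ → ℂ) (z : ℂ) : ℂ := (fderiv ℝ f z 1 + Complex.I * fderiv ℝ f z Complex.I) / 2

theorem dz_eq_wirt {M : Set ℂ} {z : ℂ} (hz : z ∈ interior M) (f : ℂ → ℂ) :
    dz M f z = wirt f z := by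
  simp [dz, wirt, fderivWithin_of_mem_nhds (mem_interior_iff_mem_nhds.1 hz)]

theorem dzbar_eq_wirtBar {M : Set ℂ} {z : ℂ} (hz : z ∈ interior M) (f : ℂ → ℂ) :
    dzbar M f z = wirtBar f z := by
  simp [dzbar, wirtBar, fderivWithin_of_mem_nhds (mem_interior_iff_mem_nhds.1 hz)]

theorem measurable_wirt (f : ℂ → ℂ) : Measurable (wirt f) := by
  unfold wirt
  have h1 := measurable_fderiv_apply_const ℝ f (1 : ℂ)
  have h2 := measurable_fderiv_apply_const ℝ f Complex.I
  fun_prop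

theorem measurable_wirtBar (f : ℂ → ℂ) : Measurable (wirtBar f) := by
  unfold wirtBar
  have h1 := measurable_fderiv_apply_const ℝ f (1 : ℂ)
  have h2 := measurable_fderiv_apply_const ℝ f Complex.I
  fun_prop

theorem norm_wirt_le (f : ℂ → ℂ) (z : ℂ) : ‖wirt f z‖ ≤ ‖fderiv ℝ f z‖ := by
  have h1 := (fderiv ℝ f z).le_opNorm 1
  have h2 := (fderiv ℝ f z).le_opNorm Complex.I
  have h3 := norm_sub_le (fderiv ℝ f z 1) (Complex.I * fderiv ℝ f z Complex.I)
  simp only [wirt, norm_div, norm_mul, Complex.norm_I, norm_one, mul_one, one_mul,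
    Complex.norm_ofNat] at *
  linarith

theorem norm_wirtBar_le (f : ℂ → ℂ) (z : ℂ) : ‖wirtBar f z‖ ≤ ‖fderiv ℝ f z‖ := by
  have h1 := (fderiv ℝ f z).le_opNorm 1
  have h2 := (fderiv ℝ f z).le_opNorm Complex.I
  have h3 := norm_add_le (fderiv ℝ f z 1) (Complex.I * fderiv ℝ f z Complex.I)
  simp only [wirtBar, norm_div, norm_mul, Complex.norm_I, norm_one, mul_one, one_mul,
    Complex.norm_ofNat] at *
  linarith

theorem wirt_congr {f g : ℂ → ℂ} {z : ℂ} (h : f =ᶠ[𝓝 z] g) : wirt f z = wirt g z := by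
  simp [wirt, h.fderiv_eq]

theorem wirtBar_congr {f g : ℂ → ℂ} {z : ℂ} (h : f =ᶠ[𝓝 z] g) : wirtBar f z = wirtBar g z := by
  simp [wirtBar, h.fderiv_eq]

theorem wirt_eq_zero_of_fderiv {f : ℂ → ℂ} {z : ℂ} (h : fderiv ℝ f z = 0) : wirt f z = 0 := by
  simp [wirt, h]

theorem wirtBar_eq_zero_of_fderiv {f : ℂ → ℂ} {z : ℂ} (h : fderiv ℝ f z = 0) :
    wirtBar f z = 0 := by
  simp [wirtBar, h]

theorem fderiv_eq_zero_of_notMem_tsupport {f : ℂ → ℂ} {z : ℂ} (h : z ∉ tsupport f) :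
    fderiv ℝ f z = 0 := by
  rw [(notMem_tsupport_iff_eventuallyEq.1 h).fderiv_eq]
  simp

theorem wirt_add {f g : ℂ → ℂ} {z : ℂ} (hf : DifferentiableAt ℝ f z)
    (hg : DifferentiableAt ℝ g z) :
    wirt (fun w => f w + g w) z = wirt f z + wirt g z := by
  simp only [wirt, fderiv_fun_add hf hg, add_apply]
  ring

theorem wirtBar_add {f g : ℂ → ℂ} {z : ℂ} (hf : DifferentiableAt ℝ f z)
    (hg : DifferentiableAt ℝ g z) :
    wirtBar (fun w => f w + g w) z = wirtBar f z + wirtBar g z := by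
  simp only [wirtBar, fderiv_fun_add hf hg, add_apply]
  ring

theorem wirt_const_mul {f : ℂ → ℂ} {z : ℂ} (hf : DifferentiableAt ℝ f z) (c : ℂ) :
    wirt (fun w => c * f w) z = c * wirt f z := by
  simp only [wirt, fderiv_const_mul hf, smul_apply, smul_eq_mul]
  ring

/-- Reduces the integral identities for plane maps to those for real Lipschitz functions and their
directional derivatives. -/
theorem fderiv_eq_lineDeriv_re_add_im {F : ℂ → ℂ} {z : ℂ} (hF : DifferentiableAt ℝ F z) (w : ℂ) :
    fderiv ℝ F z w = lineDeriv ℝ (fun x => (F x).re) z w +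
      lineDeriv ℝ (fun x => (F x).im) z w * Complex.I := by
  have h1 : HasFDerivAt (fun x => (F x).re) (Complex.reCLM.comp (fderiv ℝ F z)) z :=
    Complex.reCLM.hasFDerivAt.comp z hF.hasFDerivAt
  have h2 : HasFDerivAt (fun x => (F x).im) (Complex.imCLM.comp (fderiv ℝ F z)) z :=
    Complex.imCLM.hasFDerivAt.comp z hF.hasFDerivAt
  rw [(h1.hasLineDerivAt w).lineDeriv, (h2.hasLineDerivAt w).lineDeriv]
  simp [Complex.re_add_im]

theorem lipschitzWith_re {F : ℂ → ℂ} {C : ℝ≥0} (hF : LipschitzWith C F) :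
    LipschitzWith C (fun x => (F x).re) :=
  LipschitzWith.of_dist_le_mul fun x y => by
    refine le_trans ?_ (hF.dist_le_mul x y)
    rw [Real.dist_eq, Complex.dist_eq, ← Complex.sub_re]
    exact Complex.abs_re_le_norm _

theorem lipschitzWith_im {F : ℂ → ℂ} {C : ℝ≥0} (hF : LipschitzWith C F) :
    LipschitzWith C (fun x => (F x).im) :=
  LipschitzWith.of_dist_le_mul fun x y => by
    refine le_trans ?_ (hF.dist_le_mul x y)
    rw [Real.dist_eq, Complex.dist_eq, ← Complex.sub_im]
    exact Complex.abs_im_le_norm _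

/-! ### The null Lagrangian, integration by parts, and orthogonality to holomorphic functions -/

/-- The Jacobian determinant `|F_z|² - |F_z̄|²` is a null Lagrangian. -/
theorem integral_jacobian_add_sub_eq_zero {F H : ℂ → ℂ} {C D : ℝ≥0} (hF : LipschitzWith C F)
    (hH : LipschitzWith D H) (h'H : HasCompactSupport H) :
    ∫ z, ((‖wirt (fun w => F w + H w) z‖ ^ 2 - ‖wirtBar (fun w => F w + H w) z‖ ^ 2) -
      (‖wirt F z‖ ^ 2 - ‖wirtBar F z‖ ^ 2)) = 0 := by
  have hu := lipschitzWith_re hF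
  have hv := lipschitzWith_im hF
  have hp := lipschitzWith_re hH
  have hq := lipschitzWith_im hH
  have h'p : HasCompactSupport (fun x => (H x).re) := h'H.comp_left (g := Complex.re) rfl
  have h'q : HasCompactSupport (fun x => (H x).im) := h'H.comp_left (g := Complex.im) rfl
  set u := fun x => (F x).re with hu_def
  set v := fun x => (F x).im with hv_def
  set p := fun x => (H x).re with hp_def
  set q := fun x => (H x).im with hq_def
  have key : ∀ {a b : ℂ → ℝ} {A B : ℝ≥0}, LipschitzWith A a → LipschitzWith B b →
      HasCompactSupport b →
      Integrable (fun z => lineDeriv ℝ a z 1 * lineDeriv ℝ b z Complex.I -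
        lineDeriv ℝ a z Complex.I * lineDeriv ℝ b z 1) ∧
      ∫ z, (lineDeriv ℝ a z 1 * lineDeriv ℝ b z Complex.I -
        lineDeriv ℝ a z Complex.I * lineDeriv ℝ b z 1) = 0 := by
    intro a b A B ha hb h'b
    have i1 := integrable_lineDeriv_mul_lineDeriv (μ := volume) ha hb h'b 1 Complex.I
    have i2 := integrable_lineDeriv_mul_lineDeriv (μ := volume) ha hb h'b Complex.I 1
    refine ⟨i1.sub i2, ?_⟩
    rw [integral_sub i1 i2, integral_lineDeriv_mul_lineDeriv_comm ha hb h'b, sub_self]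
  obtain ⟨i1, e1⟩ := key hu hq h'q
  obtain ⟨i2, e2⟩ := key hv hp h'p
  obtain ⟨i3, e3⟩ := key hp hq h'q
  -- With `F = u + iv` and `H = p + iq`, expanding the determinant bilinearly leaves the 2×2
  -- determinants of `(u, q)`, `(v, p)` and `(p, q)`. Each has a compactly supported second entry,
  -- so it integrates to zero by exchanging mixed derivatives.
  have hae : (fun z => ((‖wirt (fun w => F w + H w) z‖ ^ 2 - ‖wirtBar (fun w => F w + H w) z‖ ^ 2) -
      (‖wirt F z‖ ^ 2 - ‖wirtBar F z‖ ^ 2))) =ᵐ[volume] fun z =>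
      ((lineDeriv ℝ u z 1 * lineDeriv ℝ q z Complex.I -
        lineDeriv ℝ u z Complex.I * lineDeriv ℝ q z 1) -
      (lineDeriv ℝ v z 1 * lineDeriv ℝ p z Complex.I -
        lineDeriv ℝ v z Complex.I * lineDeriv ℝ p z 1)) +
      (lineDeriv ℝ p z 1 * lineDeriv ℝ q z Complex.I -
        lineDeriv ℝ p z Complex.I * lineDeriv ℝ q z 1) := by
    filter_upwards [hF.ae_differentiableAt (μ := volume), hH.ae_differentiableAt (μ := volume)]
      with z hFz hHz
    rw [wirt_add hFz hHz, wirtBar_add hFz hHz]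
    simp only [wirt, wirtBar, fderiv_eq_lineDeriv_re_add_im hFz, fderiv_eq_lineDeriv_re_add_im hHz,
      ← hu_def, ← hv_def, ← hp_def, ← hq_def]
    generalize lineDeriv ℝ u z 1 = u1
    generalize lineDeriv ℝ v z 1 = v1
    generalize lineDeriv ℝ p z 1 = p1
    generalize lineDeriv ℝ q z 1 = q1
    generalize lineDeriv ℝ u z Complex.I = u2
    generalize lineDeriv ℝ v z Complex.I = v2
    generalize lineDeriv ℝ p z Complex.I = p2
    generalize lineDeriv ℝ q z Complex.I = q2
    simp only [← Complex.normSq_eq_norm_sq, Complex.normSq_apply, Complex.div_ofNat_re,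
      Complex.div_ofNat_im,
      Complex.add_re, Complex.add_im, Complex.sub_re, Complex.sub_im, Complex.mul_re,
      Complex.mul_im, Complex.I_re, Complex.I_im, Complex.ofReal_re, Complex.ofReal_im]
    ring
  rw [integral_congr_ae hae, integral_add (i1.sub' i2) i3, integral_sub i1 i2, e1, e2, e3]
  simp

/-- Integration by parts for the Wirtinger derivatives of Lipschitz maps. -/
theorem integral_re_conj_mul_wirt {ψ H : ℂ → ℂ} {C D : ℝ≥0} (hψ : LipschitzWith C ψ)
    (hH : LipschitzWith D H) (h'H : HasCompactSupport H) :
    ∫ z, (conj (ψ z) * wirt H z).re = -∫ z, (conj (H z) * wirtBar ψ z).re := by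
  have hu := lipschitzWith_re hψ
  have hv := lipschitzWith_im hψ
  have hp := lipschitzWith_re hH
  have hq := lipschitzWith_im hH
  have h'p : HasCompactSupport (fun x => (H x).re) := h'H.comp_left (g := Complex.re) rfl
  have h'q : HasCompactSupport (fun x => (H x).im) := h'H.comp_left (g := Complex.im) rfl
  set u := fun x => (ψ x).re with hu_def
  set v := fun x => (ψ x).im with hv_def
  set p := fun x => (H x).re with hp_def
  set q := fun x => (H x).im with hq_def
  have key : ∀ {a b : ℂ → ℝ} {A B : ℝ≥0}, LipschitzWith A a → LipschitzWith B b →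
      HasCompactSupport b → ∀ w : ℂ,
      Integrable (fun z => lineDeriv ℝ a z w * b z) ∧
      Integrable (fun z => a z * lineDeriv ℝ b z w) ∧
      ∫ z, a z * lineDeriv ℝ b z w = - ∫ z, lineDeriv ℝ a z w * b z := by
    intro a b A B ha hb h'b w
    refine ⟨?_, ?_, ?_⟩
    · have := (ha.locallyIntegrable_lineDeriv (μ := volume)
        w).integrable_smul_left_of_hasCompactSupport hb.continuous h'b
      simpa [mul_comm] using this
    · refine (integrableOn_iff_integrable_of_support_subset (s := tsupport b) ?_).1 ?_
      · intro z hz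
        by_contra h
        refine hz ?_
        simp only
        rw [(notMem_tsupport_iff_eventuallyEq.1 h).lineDeriv_eq]
        simp [lineDeriv]
      · exact ((integrable_lineDeriv_of_hasCompactSupport hb h'b
          w).integrableOn).continuousOn_mul ha.continuous.continuousOn h'b
    · rw [ha.integral_lineDeriv_mul_eq hb h'b, ← integral_neg]
      simp only [lineDeriv_neg, neg_mul, neg_neg]
      simp only [mul_comm]
  obtain ⟨i1, j1, e1⟩ := key hu hp h'p 1
  obtain ⟨i2, j2, e2⟩ := key hu hq h'q Complex.I
  obtain ⟨i3, j3, e3⟩ := key hv hq h'q 1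
  obtain ⟨i4, j4, e4⟩ := key hv hp h'p Complex.I
  have hae1 : (fun z => (conj (ψ z) * wirt H z).re) =ᵐ[volume] fun z =>
      ((u z * lineDeriv ℝ p z 1 + u z * lineDeriv ℝ q z Complex.I) +
        (v z * lineDeriv ℝ q z 1 - v z * lineDeriv ℝ p z Complex.I)) / 2 := by
    filter_upwards [hH.ae_differentiableAt (μ := volume)] with z hHz
    simp only [wirt, fderiv_eq_lineDeriv_re_add_im hHz, ← hp_def, ← hq_def]
    simp only [Complex.mul_re, Complex.conj_re, Complex.conj_im, Complex.div_ofNat_re,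
      Complex.div_ofNat_im, Complex.add_re, Complex.add_im, Complex.sub_re, Complex.sub_im,
      Complex.mul_im, Complex.I_re, Complex.I_im, Complex.ofReal_re, Complex.ofReal_im, u, v]
    ring
  have hae2 : (fun z => (conj (H z) * wirtBar ψ z).re) =ᵐ[volume] fun z =>
      ((lineDeriv ℝ u z 1 * p z + lineDeriv ℝ u z Complex.I * q z) +
        (lineDeriv ℝ v z 1 * q z - lineDeriv ℝ v z Complex.I * p z)) / 2 := by
    filter_upwards [hψ.ae_differentiableAt (μ := volume)] with z hz
    simp only [wirtBar, fderiv_eq_lineDeriv_re_add_im hz, ← hu_def, ← hv_def]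
    simp only [Complex.mul_re, Complex.conj_re, Complex.conj_im, Complex.div_ofNat_re,
      Complex.div_ofNat_im, Complex.add_re, Complex.add_im,
      Complex.mul_im, Complex.I_re, Complex.I_im, Complex.ofReal_re, Complex.ofReal_im, p, q]
    ring
  rw [integral_congr_ae hae1, integral_congr_ae hae2, integral_div, integral_div,
    integral_add (j1.fun_add j2) (j3.sub' j4), integral_add j1 j2, integral_sub j3 j4,
    integral_add (i1.fun_add i2) (i3.sub' i4), integral_add i1 i2, integral_sub i3 i4, e1, e2, e3, e4]
  ring

/-- A map which is `C¹` on a neighbourhood of a compact set agrees near that set with a compactly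
supported `C¹` map. -/
theorem exists_contDiff_hasCompactSupport_eventuallyEq {φ : ℂ → ℂ} {O K : Set ℂ} (hO : IsOpen O)
    (hφ : ContDiffOn ℝ 1 φ O) (hK : IsCompact K) (hKO : K ⊆ O) :
    ∃ ψ : ℂ → ℂ, ContDiff ℝ 1 ψ ∧ HasCompactSupport ψ ∧ ∀ z ∈ K, ψ =ᶠ[𝓝 z] φ := by
  obtain ⟨L, hL, hKL, hLO⟩ := exists_compact_between hK hO hKO
  obtain ⟨χ, hχ1, hχ0, -⟩ := exists_contMDiffMap_one_nhds_of_subset_interior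
    (modelWithCornersSelf ℝ ℂ) (n := 1) hK.isClosed hKL
  have hχ : ContDiff ℝ 1 χ := χ.contMDiff.contDiff
  have hsupp : tsupport (fun z => χ z • φ z) ⊆ L :=
    closure_minimal (fun z hz => by
      by_contra h
      exact hz (by simp [hχ0 z h])) hL.isClosed
  refine ⟨fun z => χ z • φ z, ?_, hL.of_isClosed_subset (isClosed_tsupport _) hsupp, ?_⟩
  · refine contDiff_iff_contDiffAt.2 fun z => ?_
    by_cases hz : z ∈ O
    · exact hχ.contDiffAt.smul (hφ.contDiffAt (hO.mem_nhds hz))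
    · have h0 := notMem_tsupport_iff_eventuallyEq.1 fun h => hz (hLO (hsupp h))
      exact (contDiffAt_const (c := (0 : ℂ))).congr_of_eventuallyEq h0
  · intro z hz
    filter_upwards [mem_nhdsSet_iff_forall.1 hχ1 z hz] with w hw
    simp [show χ w = 1 from hw]

/-- Only the germ of `φ` along the support of `H` enters, so `φ` may be replaced by a compactly
supported `C¹` map, which is globally Lipschitz. -/
theorem integral_re_conj_mul_wirt_of_contDiffOn {φ H : ℂ → ℂ} {D : ℝ≥0} {O : Set ℂ}
    (hO : IsOpen O) (hφ : ContDiffOn ℝ 1 φ O)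
    (hH : LipschitzWith D H) (h'H : HasCompactSupport H) (hHO : tsupport H ⊆ O) :
    ∫ z, (conj (φ z) * wirt H z).re = -∫ z, (conj (H z) * wirtBar φ z).re := by
  obtain ⟨ψ, hψ, h'ψ, hψφ⟩ := exists_contDiff_hasCompactSupport_eventuallyEq hO hφ h'H hHO
  obtain ⟨C, hC⟩ := hψ.lipschitzWith_of_hasCompactSupport h'ψ one_ne_zero
  have key := integral_re_conj_mul_wirt hC hH h'H
  convert key using 2
  · ext z
    by_cases hz : z ∈ tsupport H
    · rw [(hψφ z hz).eq_of_nhds]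
    · rw [wirt_eq_zero_of_fderiv (fderiv_eq_zero_of_notMem_tsupport hz)]
      simp
  · congr 1
    ext z
    by_cases hz : z ∈ tsupport H
    · rw [wirtBar_congr (hψφ z hz)]
    · simp [image_eq_zero_of_notMem_tsupport hz]

/-- A holomorphic function is orthogonal to the `z`-derivatives of all Lipschitz maps vanishing
outside its domain. -/
theorem integral_re_conj_mul_wirt_eq_zero {φ H : ℂ → ℂ} {D : ℝ≥0} {Ω : Set ℂ} {B : ℝ}
    (hΩ : IsOpen Ω) (hΩfin : volume Ω ≠ ⊤) (hφ : DifferentiableOn ℂ φ Ω)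
    (hB : ∀ z ∈ Ω, ‖φ z‖ ≤ B)
    (hH : LipschitzWith D H) (h'H : HasCompactSupport H) (hH0 : ∀ z ∉ Ω, H z = 0) :
    ∫ z in Ω, (conj (φ z) * wirt H z).re = 0 := by
  -- `H` vanishes off `Ω` but its support may touch the boundary, near which `φ` need not be
  -- regular. The truncation is in the target: `T` is Lipschitz, zero on the unit disc and the
  -- identity outside radius `2`. Then `Hn = T((n+1)H)/(n+1)` vanishes where `|H| ≤ 1/(n+1)`, so its
  -- support lies in `Ω`, whatever the shape of `Ω`. The two scalings cancel, giving a Lipschitz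
  -- constant independent of `n`.
  let θ : ContDiffBump (0 : ℂ) := ⟨1, 2, by norm_num, by norm_num⟩
  have hS : HasCompactSupport (fun w : ℂ => θ w • w) := θ.hasCompactSupport.smul_right
  have hS1 : ContDiff ℝ 1 (fun w : ℂ => θ w • w) := θ.contDiff.smul contDiff_id
  obtain ⟨L, hL⟩ := hS1.lipschitzWith_of_hasCompactSupport hS one_ne_zero
  have hT : LipschitzWith (1 + L) (fun w : ℂ => w - θ w • w) := LipschitzWith.id.sub hL
  have hT0 : ∀ w : ℂ, ‖w‖ ≤ 1 → w - θ w • w = 0 := fun w hw => by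
    rw [θ.one_of_mem_closedBall (by simpa using hw), one_smul, sub_self]
  have hT1 : ∀ w : ℂ, 2 ≤ ‖w‖ → w - θ w • w = w := fun w hw => by
    rw [θ.zero_of_le_dist (by simpa using hw), zero_smul, sub_zero]
  set T : ℂ → ℂ := fun w => w - θ w • w with hTdef
  set Hn : ℕ → ℂ → ℂ := fun n z => ((n : ℝ) + 1)⁻¹ • T (((n : ℝ) + 1) • H z) with hHn
  have hn0 : ∀ n : ℕ, (0 : ℝ) < (n : ℝ) + 1 := fun n => by positivity
  have hHnL : ∀ n, LipschitzWith ((1 + L) * D) (Hn n) := by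
    intro n
    refine LipschitzWith.of_dist_le_mul fun x y => ?_
    have h1 := hT.dist_le_mul (((n : ℝ) + 1) • H x) (((n : ℝ) + 1) • H y)
    have h2 := hH.dist_le_mul x y
    rw [dist_smul₀, Real.norm_of_nonneg (hn0 n).le] at h1
    simp only [hHn]
    rw [dist_smul₀, norm_inv, Real.norm_of_nonneg (hn0 n).le]
    calc ((n : ℝ) + 1)⁻¹ * dist (T (((n : ℝ) + 1) • H x)) (T (((n : ℝ) + 1) • H y))
        ≤ ((n : ℝ) + 1)⁻¹ * (((1 + L : ℝ≥0) : ℝ) * (((n : ℝ) + 1) * dist (H x) (H y))) := by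
          have := (hn0 n).le
          gcongr
      _ = ((1 + L : ℝ≥0) : ℝ) * dist (H x) (H y) := by
          have := (hn0 n).ne'
          field_simp
      _ ≤ ((1 + L : ℝ≥0) : ℝ) * (D * dist x y) := by gcongr
      _ = _ := by push_cast; ring
  have hHn0 : ∀ (n : ℕ) (z : ℂ), ‖H z‖ ≤ ((n : ℝ) + 1)⁻¹ → Hn n z = 0 := by
    intro n z hz
    have : T (((n : ℝ) + 1) • H z) = 0 := by
      refine hT0 _ ?_
      rw [norm_smul, Real.norm_of_nonneg (hn0 n).le]
      have := mul_le_mul_of_nonneg_left hz (hn0 n).le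
      rwa [mul_inv_cancel₀ (hn0 n).ne'] at this
    simp only [hHn, this, smul_zero]
  have hsupp : ∀ n, tsupport (Hn n) ⊆ {z | ((n : ℝ) + 1)⁻¹ ≤ ‖H z‖} := by
    intro n
    refine closure_minimal (fun z hz => ?_)
      (isClosed_le continuous_const hH.continuous.norm)
    by_contra h
    exact hz (hHn0 n z (not_le.1 h).le)
  have hsuppΩ : ∀ n, tsupport (Hn n) ⊆ Ω := by
    intro n z hz
    by_contra h
    have h1 : ((n : ℝ) + 1)⁻¹ ≤ ‖H z‖ := hsupp n hz
    rw [hH0 z h, norm_zero] at h1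
    exact absurd h1 (not_le.2 (inv_pos.2 (hn0 n)))
  have hcomp : ∀ n, HasCompactSupport (Hn n) := fun n =>
    HasCompactSupport.intro h'H fun z hz => hHn0 n z (by
      rw [image_eq_zero_of_notMem_tsupport hz, norm_zero]
      exact (inv_pos.2 (hn0 n)).le)
  have hφ1 : ContDiffOn ℝ 1 φ Ω := (hφ.contDiffOn (n := 1) hΩ).restrict_scalars ℝ
  have hzero : ∀ n, ∫ z in Ω, (conj (φ z) * wirt (Hn n) z).re = 0 := by
    intro n
    have h1 := integral_re_conj_mul_wirt_of_contDiffOn hΩ hφ1 (hHnL n) (hcomp n) (hsuppΩ n)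
    have h2 : ∀ z, (conj (Hn n z) * wirtBar φ z).re = 0 := by
      intro z
      by_cases hz : z ∈ Ω
      · have hd : HasFDerivAt φ ((fderiv ℂ φ z).restrictScalars ℝ) z :=
          (hφ.differentiableAt (hΩ.mem_nhds hz)).hasFDerivAt.restrictScalars ℝ
        have h3 : fderiv ℂ φ z Complex.I = Complex.I * fderiv ℂ φ z 1 := by
          rw [← smul_eq_mul, ← map_smul, smul_eq_mul, mul_one]
        have : wirtBar φ z = 0 := by
          simp only [wirtBar, hd.fderiv, ContinuousLinearMap.coe_restrictScalars', h3]
          rw [← mul_assoc, Complex.I_mul_I]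
          ring
        simp [this]
      · simp [image_eq_zero_of_notMem_tsupport fun h => hz (hsuppΩ n h)]
    simp only [h2, integral_zero, neg_zero] at h1
    rw [setIntegral_eq_integral_of_forall_compl_eq_zero, h1]
    intro z hz
    rw [wirt_eq_zero_of_fderiv
      (fderiv_eq_zero_of_notMem_tsupport fun h => hz (hsuppΩ n h))]
    simp
  have hlim : Tendsto (fun n => ∫ z in Ω, (conj (φ z) * wirt (Hn n) z).re) atTop
      (𝓝 (∫ z in Ω, (conj (φ z) * wirt H z).re)) := by
    have : IsFiniteMeasure (volume.restrict Ω) := ⟨by simpa using hΩfin.lt_top⟩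
    have hφm : AEStronglyMeasurable φ (volume.restrict Ω) :=
      hφ.continuousOn.aestronglyMeasurable hΩ.measurableSet
    refine tendsto_integral_of_dominated_convergence
      (fun _ => B * (((1 + L) * D : ℝ≥0) : ℝ)) (fun n => ?_) (integrable_const _) (fun n => ?_) ?_
    · exact Complex.continuous_re.comp_aestronglyMeasurable
        ((Complex.continuous_conj.comp_aestronglyMeasurable hφm).mul
          (measurable_wirt _).aestronglyMeasurable)
    · filter_upwards [ae_restrict_mem hΩ.measurableSet] with z hz
      rw [Real.norm_eq_abs]
      refine (Complex.abs_re_le_norm _).trans ?_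
      rw [norm_mul, RCLike.norm_conj]
      exact mul_le_mul (hB z hz)
        ((norm_wirt_le _ _).trans (norm_fderiv_le_of_lipschitz ℝ (hHnL n)))
        (norm_nonneg _) ((norm_nonneg _).trans (hB z hz))
    -- Where `H z ≠ 0`, `Hn` equals `H` near `z` for large `n`. On the zero set of `H`, the
    -- derivative of `H` vanishes almost everywhere and that of `Hn` vanishes everywhere.
    · filter_upwards [ae_restrict_of_ae (ae_fderiv_eq_zero_of_eq_zero (μ := volume) hH)] with z hz
      have : ∀ᶠ n : ℕ in atTop, wirt (Hn n) z = wirt H z := by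
        by_cases h0 : H z = 0
        · refine Eventually.of_forall fun n => ?_
          rw [wirt_eq_zero_of_fderiv (hz h0), wirt_eq_zero_of_fderiv]
          refine fderiv_eq_zero_of_notMem_tsupport fun h => ?_
          have h1 : ((n : ℝ) + 1)⁻¹ ≤ ‖H z‖ := hsupp n h
          rw [h0, norm_zero] at h1
          exact absurd h1 (not_le.2 (inv_pos.2 (hn0 n)))
        · have hpos : 0 < ‖H z‖ := norm_pos_iff.2 h0
          have ht : Tendsto (fun n : ℕ => ((n : ℝ) + 1) * ‖H z‖) atTop atTop :=
            (tendsto_atTop_add_const_right _ _ tendsto_natCast_atTop_atTop).atTop_mul_const hpos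
          filter_upwards [ht.eventually_gt_atTop 2] with n hn
          refine wirt_congr ?_
          have hc : ContinuousAt (fun w => ((n : ℝ) + 1) * ‖H w‖) z :=
            (hH.continuous.norm.const_mul _).continuousAt
          filter_upwards [hc.eventually (lt_mem_nhds hn)] with w hw
          have : T (((n : ℝ) + 1) • H w) = ((n : ℝ) + 1) • H w := by
            refine hT1 _ ?_
            rw [norm_smul, Real.norm_of_nonneg (hn0 n).le]
            exact hw.le
          simp only [hHn, this]
          exact inv_smul_smul₀ (hn0 n).ne' _
      refine tendsto_const_nhds.congr' ?_
      filter_upwards [this] with n hn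
      rw [hn]
  simp only [hzero] at hlim
  exact (tendsto_nhds_unique hlim tendsto_const_nhds)

/-! ### Convexity and derivatives of the potential -/

section Admissible

variable {V : ℝ → ℝ}

theorem IsAdmissible.continuousOn (hV : IsAdmissible V) : ContinuousOn V (Ici 0) := by
  intro x hx
  rcases (mem_Ici.1 hx).eq_or_lt with rfl | h
  · exact continuousWithinAt_Ioi_iff_Ici.1 hV.tendsto_zero
  · exact (hV.smooth.continuousOn.continuousAt (Ioi_mem_nhds h)).continuousWithinAt

theorem IsAdmissible.hasDerivAt (hV : IsAdmissible V) {x : ℝ} (hx : 0 < x) :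
    HasDerivAt V (deriv V x) x :=
  ((hV.smooth.contDiffAt (Ioi_mem_nhds hx)).differentiableAt (by simp)).hasDerivAt

theorem IsAdmissible.contDiffOn_deriv (hV : IsAdmissible V) : ContDiffOn ℝ ∞ (deriv V) (Ioi 0) :=
  ((contDiffOn_infty_iff_deriv_of_isOpen isOpen_Ioi).1 hV.smooth).2

theorem IsAdmissible.hasDerivAt_deriv (hV : IsAdmissible V) {x : ℝ} (hx : 0 < x) :
    HasDerivAt (deriv V) (deriv (deriv V) x) x :=
  ((hV.contDiffOn_deriv.contDiffAt (Ioi_mem_nhds hx)).differentiableAt (by simp)).hasDerivAt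

theorem IsAdmissible.continuousOn_deriv_deriv (hV : IsAdmissible V) :
    ContinuousOn (deriv (deriv V)) (Ioi 0) :=
  ((contDiffOn_infty_iff_deriv_of_isOpen isOpen_Ioi).1 hV.contDiffOn_deriv).2.continuousOn

theorem IsAdmissible.deriv_mono (hV : IsAdmissible V) {x y : ℝ} (hx : 0 < x) (hxy : x ≤ y) :
    deriv V x ≤ deriv V y :=
  hV.strictConvexOn.convexOn.monotoneOn_deriv
    (fun _ hz => (hV.hasDerivAt hz).differentiableAt) hx (hx.trans_le hxy) hxy

/-- The graph of `V` lies above its tangent lines. -/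
theorem IsAdmissible.tangent_le (hV : IsAdmissible V) {x y : ℝ} (hx : 0 < x) (hy : 0 ≤ y) :
    V x + deriv V x * (y - x) ≤ V y := by
  have key : ∀ z : ℝ, 0 < z → V x + deriv V x * (z - x) ≤ V z := by
    intro z hz
    rcases lt_trichotomy x z with h | rfl | h
    · have := hV.strictConvexOn.convexOn.le_slope_of_hasDerivAt hx hz h (hV.hasDerivAt hx)
      rw [slope_def_field, le_div_iff₀ (by linarith)] at this
      linarith
    · simp
    · have := hV.strictConvexOn.convexOn.slope_le_of_hasDerivAt hz hx h (hV.hasDerivAt hx)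
      rw [slope_def_field, div_le_iff₀ (by linarith)] at this
      linarith
  -- Convexity is assumed only on the open half-line; the endpoint `0` is reached in the limit.
  rcases hy.eq_or_lt with rfl | hy
  · have h1 : Tendsto (fun z => V x + deriv V x * (z - x)) (𝓝[>] 0)
        (𝓝 (V x + deriv V x * (0 - x))) :=
      (Continuous.tendsto (by fun_prop) 0).mono_left nhdsWithin_le_nhds
    refine le_of_tendsto_of_tendsto h1 hV.tendsto_zero ?_
    filter_upwards [self_mem_nhdsWithin] with z hz using key z hz
  · exact key y hy

/-- The stored energy density `V(|w|²) + |w|²`, the part of the energy density left after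
subtracting the Jacobian determinant. -/
def potential (V : ℝ → ℝ) (w : ℂ) : ℝ := V (‖w‖ ^ 2) + ‖w‖ ^ 2

theorem IsAdmissible.continuous_potential (hV : IsAdmissible V) : Continuous (potential V) :=
  (hV.continuousOn.comp_continuous (by fun_prop) fun w => mem_Ici.2 (by positivity)).add
    (by fun_prop)

/-- The first derivative of `potential V` at `w` in direction `b`. -/
def potentialDeriv (V : ℝ → ℝ) (w b : ℂ) : ℝ := 2 * (1 + deriv V (‖w‖ ^ 2)) * (conj w * b).re

/-- The second derivative of `potential V` at `w` in direction `b`. -/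
def potentialDeriv₂ (V : ℝ → ℝ) (w b : ℂ) : ℝ :=
  2 * (1 + deriv V (‖w‖ ^ 2)) * ‖b‖ ^ 2 + 4 * deriv (deriv V) (‖w‖ ^ 2) * (conj w * b).re ^ 2

/-- The tangent-line inequality for `V` at `|w₀|²`, combined with `|w|² - |w₀|² = 2 Re(conj w₀ (w -
w₀)) + |w - w₀|²`. The quadratic remainder is what yields both minimality and strictness; the sign
of `1 + V'` plays no role yet. -/
theorem IsAdmissible.potential_ge (hV : IsAdmissible V) {w₀ : ℂ} (h0 : w₀ ≠ 0) (w : ℂ) :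
    potential V w₀ + potentialDeriv V w₀ (w - w₀) + (1 + deriv V (‖w₀‖ ^ 2)) * ‖w - w₀‖ ^ 2 ≤
      potential V w := by
  have h := hV.tangent_le (x := ‖w₀‖ ^ 2) (y := ‖w‖ ^ 2) (by positivity) (by positivity)
  have e : ‖w‖ ^ 2 - ‖w₀‖ ^ 2 = 2 * (conj w₀ * (w - w₀)).re + ‖w - w₀‖ ^ 2 := by
    simp only [← Complex.normSq_eq_norm_sq, Complex.normSq_apply, Complex.mul_re, Complex.sub_re,
      Complex.sub_im, Complex.conj_re, Complex.conj_im]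
    ring
  rw [e] at h
  simp only [potential, potentialDeriv]
  nlinarith

/-- The tangent to `V` at `|w|²`, evaluated at `0`, gives `V(|w|²) - V'(|w|²)|w|² ≤ V(0)`, and here
`-V'(|w|²) > 1`. This rules out open sets on which `f_z = 0`. -/
theorem IsAdmissible.potential_lt_zero (hV : IsAdmissible V) {w : ℂ} (hw : w ≠ 0)
    (h : 1 + deriv V (‖w‖ ^ 2) < 0) : potential V w < potential V 0 := by
  have hpos : 0 < ‖w‖ ^ 2 := by positivity
  have h1 := hV.tangent_le hpos le_rfl
  simp only [potential, norm_zero, ne_eq, OfNat.ofNat_ne_zero, not_false_eq_true, zero_pow]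
  nlinarith

theorem hasDerivAt_norm_sq_add_mul (a b : ℂ) (t : ℝ) :
    HasDerivAt (fun s : ℝ => ‖a + s * b‖ ^ 2) (2 * (conj (a + t * b) * b).re) t := by
  have h : ∀ s : ℝ, ‖a + s * b‖ ^ 2 = (a.re + s * b.re) ^ 2 + (a.im + s * b.im) ^ 2 := by
    intro s
    simp only [← Complex.normSq_eq_norm_sq, Complex.normSq_apply, Complex.add_re, Complex.add_im,
      Complex.mul_re, Complex.mul_im, Complex.ofReal_re, Complex.ofReal_im]
    ring
  simp only [h]
  have h1 : HasDerivAt (fun s : ℝ => a.re + s * b.re) b.re t := by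
    simpa using ((hasDerivAt_id t).mul_const b.re).const_add a.re
  have h2 : HasDerivAt (fun s : ℝ => a.im + s * b.im) b.im t := by
    simpa using ((hasDerivAt_id t).mul_const b.im).const_add a.im
  refine ((h1.fun_pow 2).add (h2.fun_pow 2)).congr_deriv ?_
  simp only [Complex.add_re, Complex.add_im, Complex.conj_re, Complex.conj_im,
    Complex.mul_re, Complex.mul_im, Complex.ofReal_re, Complex.ofReal_im]
  ring

theorem hasDerivAt_re_conj_add_mul (a b : ℂ) (t : ℝ) :
    HasDerivAt (fun s : ℝ => (conj (a + s * b) * b).re) (‖b‖ ^ 2) t := by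
  have h : ∀ s : ℝ, (conj (a + s * b) * b).re = (conj a * b).re + s * ‖b‖ ^ 2 := by
    intro s
    simp only [← Complex.normSq_eq_norm_sq, Complex.normSq_apply, Complex.add_re, Complex.add_im,
      Complex.mul_re, Complex.mul_im, Complex.ofReal_re, Complex.ofReal_im, Complex.conj_re,
      Complex.conj_im]
    ring
  simp only [h]
  simpa using ((hasDerivAt_id t).mul_const (‖b‖ ^ 2)).const_add (conj a * b).re

theorem IsAdmissible.hasDerivAt_potential (hV : IsAdmissible V) {a b : ℂ} {t : ℝ}
    (h : a + t * b ≠ 0) :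
    HasDerivAt (fun s : ℝ => potential V (a + s * b)) (potentialDeriv V (a + t * b) b) t := by
  have h1 := hasDerivAt_norm_sq_add_mul a b t
  have h2 := (hV.hasDerivAt (x := ‖a + t * b‖ ^ 2) (by positivity)).comp t h1
  refine (h2.add h1).congr_deriv ?_
  simp only [potentialDeriv]
  ring

theorem IsAdmissible.hasDerivAt_potentialDeriv (hV : IsAdmissible V) {a b : ℂ} {t : ℝ}
    (h : a + t * b ≠ 0) :
    HasDerivAt (fun s : ℝ => potentialDeriv V (a + s * b) b) (potentialDeriv₂ V (a + t * b) b)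
      t := by
  have h1 := hasDerivAt_norm_sq_add_mul a b t
  have h2 := (hV.hasDerivAt_deriv (x := ‖a + t * b‖ ^ 2) (by positivity)).comp t h1
  have h3 := ((h2.const_add 1).const_mul 2).mul (hasDerivAt_re_conj_add_mul a b t)
  refine h3.congr_deriv ?_
  simp only [potentialDeriv₂, Function.comp]
  ring

end Admissible

/-! ### Differentiation under the integral -/

/-- Differentiation under the integral sign, when the integrand depends on the parameter only over
a compact set, where its derivative is continuous. -/
theorem hasDerivAt_integral_of_continuousOn {K : Set ℂ} (hK : IsCompact K) {μ : Measure ℂ}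
    [IsFiniteMeasure μ] {F F' : ℝ → ℂ → ℝ} {δ : ℝ}
    (hm : ∀ t, AEStronglyMeasurable (F t) μ) (hm' : ∀ t, AEStronglyMeasurable (F' t) μ)
    (hi : ∀ t ∈ Ioo (-δ) δ, Integrable (F t) μ)
    (hd : ∀ z ∈ K, ∀ t ∈ Ioo (-δ) δ, HasDerivAt (fun s => F s z) (F' t z) t)
    (hc : ContinuousOn (fun q : ℝ × ℂ => F' q.1 q.2) (Icc (-δ) δ ×ˢ K))
    (h0 : ∀ z ∉ K, ∀ t, F t z = F 0 z) (h0' : ∀ z ∉ K, ∀ t, F' t z = 0) {t : ℝ}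
    (ht : t ∈ Ioo (-δ) δ) :
    Integrable (F' t) μ ∧ HasDerivAt (fun s => ∫ z, F s z ∂μ) (∫ z, F' t z ∂μ) t := by
  obtain ⟨B, hB⟩ := (isCompact_Icc.prod hK).exists_bound_of_continuousOn hc
  refine hasDerivAt_integral_of_dominated_loc_of_deriv_le (bound := fun _ => max B 0)
    (isOpen_Ioo.mem_nhds ht) (Eventually.of_forall hm) (hi t ht) (hm' t)
    (Eventually.of_forall fun z s hs => ?_) (integrable_const _)
    (Eventually.of_forall fun z s hs => ?_)
  · by_cases hz : z ∈ K
    · exact (hB (s, z) ⟨Ioo_subset_Icc_self hs, hz⟩).trans (le_max_left _ _)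
    · simp [h0' z hz]
  · by_cases hz : z ∈ K
    · exact hd z hz s hs
    · rw [h0' z hz]
      have : (fun s => F s z) = fun _ => F 0 z := funext (h0 z hz)
      rw [this]
      exact hasDerivAt_const _ _

/-- `V` is differentiable only away from `0`, so `a + t b` must stay off the origin over `K`;
compactness provides this for small `t`. Off `K` the integrand does not depend on `t`, so the
behaviour of `a` there is irrelevant. -/
theorem IsAdmissible.hasDerivAt_integral_potential {V : ℝ → ℝ} (hV : IsAdmissible V)
    {μ : Measure ℂ} [IsFiniteMeasure μ] {a b : ℂ → ℂ} {K : Set ℂ} (hK : IsCompact K)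
    (ha : Measurable a) (hb : Measurable b) (hac : ContinuousOn a K) (hbc : ContinuousOn b K)
    (ha0 : ∀ z ∈ K, a z ≠ 0) (hb0 : ∀ z ∉ K, b z = 0)
    (hi : ∀ t : ℝ, Integrable (fun z => potential V (a z + t * b z)) μ) :
    ∃ δ > 0, (∀ t : ℝ, t ∈ Ioo (-δ) δ → HasDerivAt (fun s : ℝ => ∫ z, potential V (a z + s * b z) ∂μ)
        (∫ z, potentialDeriv V (a z + t * b z) (b z) ∂μ) t) ∧
      HasDerivAt (fun s : ℝ => ∫ z, potentialDeriv V (a z + s * b z) (b z) ∂μ)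
        (∫ z, potentialDeriv₂ V (a z) (b z) ∂μ) 0 := by
  obtain ⟨m, hm, hma⟩ : ∃ m > 0, ∀ z ∈ K, m ≤ ‖a z‖ := by
    rcases K.eq_empty_or_nonempty with rfl | hne
    · exact ⟨1, one_pos, by simp⟩
    · obtain ⟨z₀, hz₀, hmin⟩ := hK.exists_isMinOn hne hac.norm
      exact ⟨‖a z₀‖, norm_pos_iff.2 (ha0 z₀ hz₀), fun z hz => hmin hz⟩
  obtain ⟨B, hB⟩ := hK.exists_bound_of_continuousOn hbc
  have hB' : 0 < max B 0 + 1 := by positivity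
  -- With this choice `|t b| ≤ m/2` on `K`, while `|a| ≥ m` there.
  set δ := m / (2 * (max B 0 + 1)) with hδ
  have hδ0 : 0 < δ := by positivity
  have hne : ∀ z ∈ K, ∀ t : ℝ, t ∈ Icc (-δ) δ → a z + t * b z ≠ 0 := by
    intro z hz t ht h
    have h1 : a z = -(t * b z) := eq_neg_of_add_eq_zero_left h
    have h2 : ‖a z‖ = |t| * ‖b z‖ := by rw [h1]; simp
    have h3 := hma z hz
    have h4 : |t| * ‖b z‖ ≤ δ * (max B 0 + 1) := by
      refine mul_le_mul (abs_le.2 ht) ?_ (norm_nonneg _) hδ0.le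
      exact ((hB z hz).trans (le_max_left _ _)).trans (by linarith)
    have h5 : δ * (max B 0 + 1) = m / 2 := by
      rw [hδ]; field_simp
    linarith
  have hmem : ∀ q ∈ Icc (-δ) δ ×ˢ K, ‖a q.2 + (q.1 : ℂ) * b q.2‖ ^ 2 ∈ Ioi (0 : ℝ) := by
    intro q hq
    have := norm_pos_iff.2 (hne q.2 hq.2 q.1 hq.1)
    exact mem_Ioi.2 (by positivity)
  have hac' : ContinuousOn (fun q : ℝ × ℂ => a q.2) (Icc (-δ) δ ×ˢ K) :=
    hac.comp continuousOn_snd fun q hq => hq.2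
  have hbc' : ContinuousOn (fun q : ℝ × ℂ => b q.2) (Icc (-δ) δ ×ˢ K) :=
    hbc.comp continuousOn_snd fun q hq => hq.2
  have hw : ContinuousOn (fun q : ℝ × ℂ => a q.2 + (q.1 : ℂ) * b q.2) (Icc (-δ) δ ×ˢ K) :=
    hac'.add ((Complex.continuous_ofReal.comp continuous_fst).continuousOn.mul hbc')
  have hre : ContinuousOn (fun q : ℝ × ℂ => (conj (a q.2 + (q.1 : ℂ) * b q.2) * b q.2).re)
      (Icc (-δ) δ ×ˢ K) :=
    Complex.continuous_re.comp_continuousOn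
      ((Complex.continuous_conj.comp_continuousOn hw).mul hbc')
  have hV1 := hV.contDiffOn_deriv.continuousOn.comp (hw.norm.pow 2) hmem
  have hV2 := hV.continuousOn_deriv_deriv.comp (hw.norm.pow 2) hmem
  have c1 : ContinuousOn (fun q : ℝ × ℂ => potentialDeriv V (a q.2 + (q.1 : ℂ) * b q.2) (b q.2))
      (Icc (-δ) δ ×ˢ K) :=
    (continuousOn_const.mul (continuousOn_const.add hV1)).mul hre
  have c2 : ContinuousOn (fun q : ℝ × ℂ => potentialDeriv₂ V (a q.2 + (q.1 : ℂ) * b q.2) (b q.2))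
      (Icc (-δ) δ ×ˢ K) :=
    ((continuousOn_const.mul (continuousOn_const.add hV1)).mul (hbc'.norm.pow 2)).add
      ((continuousOn_const.mul hV2).mul (hre.pow 2))
  have hV1m := measurable_deriv V
  have hV2m := measurable_deriv (deriv V)
  have m1 : ∀ t : ℝ, AEStronglyMeasurable
      (fun z => potentialDeriv V (a z + (t : ℂ) * b z) (b z)) μ := fun t => by
    refine Measurable.aestronglyMeasurable ?_
    unfold potentialDeriv
    have := Complex.continuous_conj.measurable
    fun_prop
  have m2 : ∀ t : ℝ, AEStronglyMeasurable
      (fun z => potentialDeriv₂ V (a z + (t : ℂ) * b z) (b z)) μ := fun t => by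
    refine Measurable.aestronglyMeasurable ?_
    unfold potentialDeriv₂
    have := Complex.continuous_conj.measurable
    fun_prop
  have key1 := fun (t : ℝ) (ht : t ∈ Ioo (-δ) δ) => hasDerivAt_integral_of_continuousOn hK
    (fun t => (hi t).aestronglyMeasurable) m1 (fun t _ => hi t)
    (fun z hz t ht => hV.hasDerivAt_potential (hne z hz t (Ioo_subset_Icc_self ht))) c1
    (fun z hz t => by simp [hb0 z hz]) (fun z hz t => by simp [hb0 z hz, potentialDeriv]) ht
  have key2 := hasDerivAt_integral_of_continuousOn hK m1 m2 (fun t ht => (key1 t ht).1)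
    (fun z hz t ht => hV.hasDerivAt_potentialDeriv (hne z hz t (Ioo_subset_Icc_self ht))) c2
    (fun z hz t => by simp [hb0 z hz, potentialDeriv])
    (fun z hz t => by simp [hb0 z hz, potentialDeriv₂]) (t := 0) ⟨by linarith, hδ0⟩
  refine ⟨δ, hδ0, fun t ht => (key1 t ht).2, ?_⟩
  simpa using key2.2

/-! ### The energy in terms of the potential -/

/-- Restricted to the interior of `M`, the difference of two Lipschitz maps on `M` with the same
boundary values is the restriction of a compactly supported Lipschitz map. -/
theorem exists_lipschitzWith_sub {M : Set ℂ} (hM : IsCompact M) {f f' : ℂ → ℂ} {C C' : ℝ≥0}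
    (hf : LipschitzOnWith C f M) (hf' : LipschitzOnWith C' f' M) (h : EqOn f' f (frontier M)) :
    ∃ (H : ℂ → ℂ) (D : ℝ≥0), LipschitzWith D H ∧ HasCompactSupport H ∧
      (∀ z ∉ interior M, H z = 0) ∧ ∀ z ∈ M, H z = f' z - f z := by
  refine ⟨M.indicator (fun z => f' z - f z), C' + C, lipschitzWith_indicator hM.isClosed
    (hf'.sub hf) (fun x hx => sub_eq_zero.2 (h hx)), ?_, ?_, fun z hz => indicator_of_mem hz _⟩
  · exact HasCompactSupport.intro hM fun z hz => indicator_of_notMem hz _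
  · intro z hz
    by_cases hzM : z ∈ M
    · have : z ∈ frontier M := by
        rw [hM.isClosed.frontier_eq]
        exact ⟨hzM, hz⟩
      rw [indicator_of_mem hzM]
      exact sub_eq_zero.2 (h this)
    · exact indicator_of_notMem hzM _

theorem ae_differentiableAt_of_lipschitzOnWith {M : Set ℂ} {f : ℂ → ℂ} {C : ℝ≥0}
    (hf : LipschitzOnWith C f M) :
    ∀ᵐ z ∂volume.restrict (interior M), DifferentiableAt ℝ f z := by
  rw [ae_restrict_iff' isOpen_interior.measurableSet]
  filter_upwards [hf.ae_differentiableWithinAt_of_mem (μ := volume)] with z hz hzM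
  exact (hz (interior_subset hzM)).differentiableAt (mem_interior_iff_mem_nhds.1 hzM)

theorem norm_wirt_le_of_lipschitzOnWith {M : Set ℂ} {f : ℂ → ℂ} {C : ℝ≥0}
    (hf : LipschitzOnWith C f M) {z : ℂ} (hz : z ∈ interior M) : ‖wirt f z‖ ≤ C :=
  (norm_wirt_le f z).trans
    (norm_fderiv_le_of_lipschitzOn ℝ (mem_interior_iff_mem_nhds.1 hz) hf)

theorem norm_wirtBar_le_of_lipschitzOnWith {M : Set ℂ} {f : ℂ → ℂ} {C : ℝ≥0}
    (hf : LipschitzOnWith C f M) {z : ℂ} (hz : z ∈ interior M) : ‖wirtBar f z‖ ≤ C :=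
  (norm_wirtBar_le f z).trans
    (norm_fderiv_le_of_lipschitzOn ℝ (mem_interior_iff_mem_nhds.1 hz) hf)

theorem isFiniteMeasure_restrict_interior {M : Set ℂ} (hM : IsCompact M) :
    IsFiniteMeasure (volume.restrict (interior M)) :=
  ⟨by simpa using (measure_mono interior_subset).trans_lt hM.measure_lt_top⟩

/-- A continuous function of a bounded measurable function is integrable. -/
theorem integrable_comp_of_norm_le {μ : Measure ℂ} [IsFiniteMeasure μ] {Φ : ℂ → ℝ}
    (hΦ : Continuous Φ) {a : ℂ → ℂ} (ha : Measurable a) {C : ℝ} (hC : ∀ᵐ z ∂μ, ‖a z‖ ≤ C) :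
    Integrable (fun z => Φ (a z)) μ := by
  obtain ⟨B, hB⟩ := (isCompact_closedBall (0 : ℂ) C).exists_bound_of_continuousOn hΦ.continuousOn
  refine Integrable.of_bound (hΦ.comp_aestronglyMeasurable ha.aestronglyMeasurable) B ?_
  filter_upwards [hC] with z hz using hB _ (by simpa using hz)

theorem IsAdmissible.integrable_potential_wirt {V : ℝ → ℝ} (hV : IsAdmissible V) {M : Set ℂ}
    (hM : IsCompact M) {f : ℂ → ℂ} {C : ℝ≥0} (hf : LipschitzOnWith C f M) :
    Integrable (fun z => potential V (wirt f z)) (volume.restrict (interior M)) := by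
  have := isFiniteMeasure_restrict_interior hM
  refine integrable_comp_of_norm_le hV.continuous_potential (measurable_wirt f) (C := C) ?_
  filter_upwards [ae_restrict_mem isOpen_interior.measurableSet] with z hz
  exact norm_wirt_le_of_lipschitzOnWith hf hz

theorem integrable_norm_sq_wirt {M : Set ℂ} (hM : IsCompact M) {f : ℂ → ℂ} {C : ℝ≥0}
    (hf : LipschitzOnWith C f M) :
    Integrable (fun z => ‖wirt f z‖ ^ 2) (volume.restrict (interior M)) := by
  have := isFiniteMeasure_restrict_interior hM
  refine integrable_comp_of_norm_le (Φ := fun w => ‖w‖ ^ 2) (by fun_prop) (measurable_wirt f)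
    (C := C) ?_
  filter_upwards [ae_restrict_mem isOpen_interior.measurableSet] with z hz
  exact norm_wirt_le_of_lipschitzOnWith hf hz

theorem integrable_norm_sq_wirtBar {M : Set ℂ} (hM : IsCompact M) {f : ℂ → ℂ} {C : ℝ≥0}
    (hf : LipschitzOnWith C f M) :
    Integrable (fun z => ‖wirtBar f z‖ ^ 2) (volume.restrict (interior M)) := by
  have := isFiniteMeasure_restrict_interior hM
  refine integrable_comp_of_norm_le (Φ := fun w => ‖w‖ ^ 2) (by fun_prop) (measurable_wirtBar f)
    (C := C) ?_
  filter_upwards [ae_restrict_mem isOpen_interior.measurableSet] with z hz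
  exact norm_wirtBar_le_of_lipschitzOnWith hf hz

/-- The integral of the Jacobian determinant only depends on the boundary values. -/
theorem integral_jacobian_eq {M : Set ℂ} (hM : IsCompact M) {f f' : ℂ → ℂ} {C C' : ℝ≥0}
    (hf : LipschitzOnWith C f M) (hf' : LipschitzOnWith C' f' M) (h : EqOn f' f (frontier M)) :
    ∫ z in interior M, (‖wirt f' z‖ ^ 2 - ‖wirtBar f' z‖ ^ 2) =
      ∫ z in interior M, (‖wirt f z‖ ^ 2 - ‖wirtBar f z‖ ^ 2) := by
  obtain ⟨H, D, hH, h'H, hH0, hHf⟩ := exists_lipschitzWith_sub hM hf hf' h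
  obtain ⟨F, hF, hFf⟩ := hf.extend_finite_dimension
  have key := integral_jacobian_add_sub_eq_zero hF hH h'H
  have hnhds : ∀ z ∈ interior M, f =ᶠ[𝓝 z] F ∧ f' =ᶠ[𝓝 z] fun w => F w + H w := by
    intro z hz
    have hmem := mem_interior_iff_mem_nhds.1 hz
    refine ⟨?_, ?_⟩ <;> filter_upwards [hmem] with w hw
    · exact hFf hw
    · rw [hHf w hw, ← hFf hw]; ring
  -- Off the interior `H` is zero, so its derivative is zero almost everywhere there and the
  -- integrand vanishes. This covers the frontier too, without knowing that it is a null set.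
  have hset := setIntegral_eq_integral_of_ae_compl_eq_zero (μ := volume) (s := interior M)
    (f := fun z => (‖wirt (fun w => F w + H w) z‖ ^ 2 - ‖wirtBar (fun w => F w + H w) z‖ ^ 2) -
      (‖wirt F z‖ ^ 2 - ‖wirtBar F z‖ ^ 2)) (by
    filter_upwards [ae_fderiv_eq_zero_of_eq_zero (μ := volume) hH,
      hF.ae_differentiableAt (μ := volume), hH.ae_differentiableAt (μ := volume)]
      with z h0 hFz hHz hz
    rw [wirt_add hFz hHz, wirtBar_add hFz hHz, wirt_eq_zero_of_fderiv (h0 (hH0 z hz)),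
      wirtBar_eq_zero_of_fderiv (h0 (hH0 z hz))]
    simp)
  rw [← sub_eq_zero, ← integral_sub
    ((integrable_norm_sq_wirt hM hf').sub' (integrable_norm_sq_wirtBar hM hf'))
    ((integrable_norm_sq_wirt hM hf).sub' (integrable_norm_sq_wirtBar hM hf))]
  refine Eq.trans ?_ (hset.trans key)
  refine setIntegral_congr_fun isOpen_interior.measurableSet fun z hz => ?_
  simp only [wirt_congr (hnhds z hz).1, wirt_congr (hnhds z hz).2,
    wirtBar_congr (hnhds z hz).1, wirtBar_congr (hnhds z hz).2]

/-- Trades `|f_z̄|²` for `|f_z|²` minus the Jacobian determinant. -/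
theorem IsAdmissible.energy_eq {V : ℝ → ℝ} (hV : IsAdmissible V) {M : Set ℂ}
    (hM : IsCompact M) {f : ℂ → ℂ} {C : ℝ≥0} (hf : LipschitzOnWith C f M) :
    energy V M f = 1 / 2 * (∫ z in interior M, potential V (wirt f z)) -
      1 / 2 * ∫ z in interior M, (‖wirt f z‖ ^ 2 - ‖wirtBar f z‖ ^ 2) := by
  rw [energy, ← mul_sub, ← integral_sub (hV.integrable_potential_wirt hM hf)
    ((integrable_norm_sq_wirt hM hf).sub' (integrable_norm_sq_wirtBar hM hf))]
  congr 1
  refine setIntegral_congr_fun isOpen_interior.measurableSet fun z hz => ?_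
  simp only [dz_eq_wirt hz, dzbar_eq_wirtBar hz, potential]
  ring

/-- Up to a term which only depends on the boundary values, the energy is the integral of
`potential V` of the Wirtinger derivative. -/
theorem IsAdmissible.energy_sub_energy {V : ℝ → ℝ} (hV : IsAdmissible V) {M : Set ℂ}
    (hM : IsCompact M) {f f' : ℂ → ℂ} {C C' : ℝ≥0}
    (hf : LipschitzOnWith C f M) (hf' : LipschitzOnWith C' f' M) (h : EqOn f' f (frontier M)) :
    energy V M f' - energy V M f = 1 / 2 * (∫ z in interior M, potential V (wirt f' z)) -
      1 / 2 * ∫ z in interior M, potential V (wirt f z) := by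
  rw [hV.energy_eq hM hf, hV.energy_eq hM hf', integral_jacobian_eq hM hf hf' h]
  ring

/-! ### The regular part, the momentum, and the energy along variations -/

theorem contDiffAt_wirt {f : ℂ → ℂ} {z : ℂ} (hf : ContDiffAt ℝ ∞ f z) :
    ContDiffAt ℝ ∞ (wirt f) z := by
  have h := hf.fderiv_right (m := ∞) (by simp)
  unfold wirt
  exact ((h.clm_apply contDiffAt_const).sub
    (contDiffAt_const.mul (h.clm_apply contDiffAt_const))).div_const _

theorem contDiffAt_of_mem_reg {M : Set ℂ} {f : ℂ → ℂ} {z : ℂ} (hz : z ∈ reg M f ∩ interior M) :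
    ContDiffAt ℝ ∞ f z :=
  hz.1.2.1.contDiffAt (mem_interior_iff_mem_nhds.1 hz.2)

theorem wirt_ne_zero_of_mem_reg {M : Set ℂ} {f : ℂ → ℂ} {z : ℂ} (hz : z ∈ reg M f ∩ interior M) :
    wirt f z ≠ 0 := by
  rw [← dz_eq_wirt hz.2]
  exact hz.1.2.2

theorem continuousOn_wirt_reg (M : Set ℂ) (f : ℂ → ℂ) :
    ContinuousOn (wirt f) (reg M f ∩ interior M) := fun _ hz =>
  (contDiffAt_wirt (contDiffAt_of_mem_reg hz)).continuousAt.continuousWithinAt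

theorem contDiffWithinAt_of_notMem_finite {M P : Set ℂ} {f : ℂ → ℂ} (hP : P.Finite)
    (hf : ContDiffOn ℝ ∞ f (M \ P)) {z : ℂ} (hz : z ∈ M) (hzP : z ∉ P) :
    ContDiffWithinAt ℝ ∞ f M z := by
  refine (hf z ⟨hz, hzP⟩).mono_of_mem_nhdsWithin ?_
  exact inter_mem_nhdsWithin M (hP.isClosed.isOpen_compl.mem_nhds hzP)

theorem isOpen_reg_inter_interior {M : Set ℂ} {f : ℂ → ℂ} (hf : AlmostSmooth M f) :
    IsOpen (reg M f ∩ interior M) := by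
  obtain ⟨P, hP, hfP⟩ := hf.2
  refine isOpen_iff_mem_nhds.2 fun z hz => ?_
  -- The point `z` may lie in `P` although `f` is smooth at it; only the other points of `P` have to
  -- be avoided.
  have h1 : (P \ {z})ᶜ ∈ 𝓝 z :=
    (hP.subset sdiff_subset).isClosed.isOpen_compl.mem_nhds (by simp)
  have h2 := (contDiffAt_wirt (contDiffAt_of_mem_reg hz)).continuousAt.eventually_ne
    (wirt_ne_zero_of_mem_reg hz)
  filter_upwards [isOpen_interior.mem_nhds hz.2, h1, h2] with w hwM hwP hw
  by_cases hwz : w = z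
  · rwa [hwz]
  · have hwP' : w ∉ P := fun h => hwP ⟨h, hwz⟩
    refine ⟨⟨interior_subset hwM,
      contDiffWithinAt_of_notMem_finite hP hfP (interior_subset hwM) hwP', ?_⟩, hwM⟩
    rwa [dz_eq_wirt hwM]

/-- The complex momentum `(1 + V'(|f_z|²)) f_z`. -/
def momentum (V : ℝ → ℝ) (f : ℂ → ℂ) (z : ℂ) : ℂ :=
  ((1 + deriv V (‖wirt f z‖ ^ 2) : ℝ) : ℂ) * wirt f z

theorem potentialDeriv_eq (V : ℝ → ℝ) (f : ℂ → ℂ) (z b : ℂ) :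
    potentialDeriv V (wirt f z) b = 2 * (conj (momentum V f z) * b).re := by
  rw [momentum, map_mul, Complex.conj_ofReal, mul_assoc, Complex.re_ofReal_mul, potentialDeriv,
    mul_assoc]

theorem contDiffOn_momentum {V : ℝ → ℝ} (hV : IsAdmissible V) (M : Set ℂ) (f : ℂ → ℂ) :
    ContDiffOn ℝ ∞ (momentum V f) (reg M f ∩ interior M) := by
  intro z hz
  have h1 := contDiffAt_wirt (contDiffAt_of_mem_reg hz)
  have h2 : 0 < ‖wirt f z‖ ^ 2 := by
    have := norm_pos_iff.2 (wirt_ne_zero_of_mem_reg hz)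
    positivity
  have h3 : ContDiffAt ℝ ∞ (fun w => deriv V (‖wirt f w‖ ^ 2)) z :=
    ContDiffAt.comp z (g := deriv V) (f := fun w => ‖wirt f w‖ ^ 2)
      (hV.contDiffOn_deriv.contDiffAt (Ioi_mem_nhds h2)) (h1.norm_sq ℝ)
  exact ((Complex.ofRealCLM.contDiff.contDiffAt.comp z (contDiffAt_const.add h3)).mul
    h1).contDiffWithinAt

theorem lipschitzOnWith_add_mul {M : Set ℂ} {f h : ℂ → ℂ} {C D : ℝ≥0}
    (hf : LipschitzOnWith C f M) (hh : LipschitzWith D h) (t : ℝ) :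
    LipschitzOnWith (C + ‖t‖₊ * D) (fun z => f z + (t : ℂ) * h z) M := by
  refine hf.add ?_
  have := ((lipschitzWith_smul t).comp hh).lipschitzOnWith (s := M)
  simpa [Function.comp_def] using this

theorem almostSmooth_add_mul {M : Set ℂ} {f h : ℂ → ℂ} (hf : AlmostSmooth M f)
    (hh : ContDiff ℝ ∞ h) (h'h : HasCompactSupport h) (t : ℝ) :
    AlmostSmooth M (fun z => f z + (t : ℂ) * h z) := by
  obtain ⟨⟨C, hC⟩, P, hP, hfP⟩ := hf
  obtain ⟨D, hD⟩ := hh.lipschitzWith_of_hasCompactSupport h'h (by simp)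
  exact ⟨⟨_, lipschitzOnWith_add_mul hC hD t⟩, P, hP,
    hfP.add (contDiff_const.mul hh).contDiffOn⟩

theorem eqOn_frontier_add_mul {M : Set ℂ} {f h : ℂ → ℂ} (hh : tsupport h ⊆ interior M) (t : ℝ) :
    EqOn (fun z => f z + (t : ℂ) * h z) f (frontier M) := fun z hz => by
  simp [image_eq_zero_of_notMem_tsupport fun h => hz.2 (hh h)]

theorem wirt_add_mul_ae {M : Set ℂ} {f h : ℂ → ℂ} {C : ℝ≥0} (hf : LipschitzOnWith C f M)
    (hh : Differentiable ℝ h) (t : ℝ) :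
    ∀ᵐ z ∂volume.restrict (interior M),
      wirt (fun w => f w + (t : ℂ) * h w) z = wirt f z + t * wirt h z := by
  filter_upwards [ae_differentiableAt_of_lipschitzOnWith hf] with z hz
  rw [wirt_add hz ((hh z).const_mul _), wirt_const_mul (hh z)]

theorem IsAdmissible.energyAlong_eq {V : ℝ → ℝ} (hV : IsAdmissible V) {M : Set ℂ}
    (hM : IsCompact M) {f h : ℂ → ℂ} (hf : AlmostSmooth M f) (hh : IsVariation (interior M) h)
    (t : ℝ) :
    energyAlong V M f h t = energy V M f +
      (1 / 2 * (∫ z in interior M, potential V (wirt f z + t * wirt h z)) -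
        1 / 2 * ∫ z in interior M, potential V (wirt f z)) := by
  obtain ⟨⟨C, hC⟩, -⟩ := hf
  obtain ⟨D, hD⟩ := hh.1.lipschitzWith_of_hasCompactSupport hh.2.1 (by simp)
  have := hV.energy_sub_energy hM hC (lipschitzOnWith_add_mul hC hD t)
    (eqOn_frontier_add_mul hh.2.2 t)
  rw [energyAlong, ← sub_eq_iff_eq_add', this]
  congr 2
  refine integral_congr_ae ?_
  filter_upwards [wirt_add_mul_ae hC (hh.1.differentiable (by simp)) t] with z hz
  rw [hz]

/-- On the compact support of `h` the derivative `f_z` is continuous and nonzero, so the potential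
can be differentiated twice under the integral. The Jacobian contributes only a constant. -/
theorem IsAdmissible.hasDerivAt_energyAlong {V : ℝ → ℝ} (hV : IsAdmissible V) {M : Set ℂ}
    (hM : IsCompact M) {f h : ℂ → ℂ} (hf : AlmostSmooth M f)
    (hh : IsVariation (reg M f ∩ interior M) h) :
    ∃ δ > 0, (∀ t : ℝ, t ∈ Ioo (-δ) δ → HasDerivAt (energyAlong V M f h)
        (1 / 2 * ∫ z in interior M, potentialDeriv V (wirt f z + t * wirt h z) (wirt h z)) t) ∧
      HasDerivAt (fun t : ℝ =>
          1 / 2 * ∫ z in interior M, potentialDeriv V (wirt f z + t * wirt h z) (wirt h z))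
        (1 / 2 * ∫ z in interior M, potentialDeriv₂ V (wirt f z) (wirt h z)) 0 := by
  have hh' : IsVariation (interior M) h := ⟨hh.1, hh.2.1, hh.2.2.trans inter_subset_right⟩
  have hsmooth := hf
  obtain ⟨⟨C, hC⟩, -⟩ := hf
  obtain ⟨D, hD⟩ := hh.1.lipschitzWith_of_hasCompactSupport hh.2.1 (by simp)
  have := isFiniteMeasure_restrict_interior hM
  obtain ⟨δ, hδ, h1, h2⟩ := hV.hasDerivAt_integral_potential (μ := volume.restrict (interior M))
    hh.2.1 (measurable_wirt f) (measurable_wirt h) ((continuousOn_wirt_reg M f).mono hh.2.2)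
    (fun z _ => (contDiffAt_wirt hh.1.contDiffAt).continuousAt.continuousWithinAt)
    (fun z hz => wirt_ne_zero_of_mem_reg (hh.2.2 hz))
    (fun z hz => wirt_eq_zero_of_fderiv (fderiv_eq_zero_of_notMem_tsupport hz))
    (fun t => (hV.integrable_potential_wirt hM (lipschitzOnWith_add_mul hC hD t)).congr (by
      filter_upwards [wirt_add_mul_ae hC (hh.1.differentiable (by simp)) t] with z hz
      rw [hz]))
  refine ⟨δ, hδ, fun t ht => ?_, h2.const_mul _⟩
  have e : energyAlong V M f h = _ := funext (hV.energyAlong_eq hM hsmooth hh')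
  rw [e]
  exact (((h1 t ht).const_mul _).sub_const _).const_add _

theorem integral_potentialDeriv_eq_integral_momentum {V : ℝ → ℝ} {M : Set ℂ} {f h : ℂ → ℂ}
    (hh : tsupport h ⊆ interior M) :
    1 / 2 * ∫ z in interior M, potentialDeriv V (wirt f z + (0 : ℝ) * wirt h z) (wirt h z) =
      ∫ z, (conj (momentum V f z) * wirt h z).re := by
  rw [← integral_const_mul, ← setIntegral_eq_integral_of_forall_compl_eq_zero (s := interior M)
    (f := fun z => (conj (momentum V f z) * wirt h z).re)]
  · refine setIntegral_congr_fun isOpen_interior.measurableSet fun z _ => ?_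
    simp only [Complex.ofReal_zero, zero_mul, add_zero, potentialDeriv_eq]
    ring
  · intro z hz
    rw [wirt_eq_zero_of_fderiv (fderiv_eq_zero_of_notMem_tsupport fun h => hz (hh h))]
    simp

/-! ### Holomorphy of the momentum -/

/-- If the first variation vanishes for all variations in the regular part, then the momentum is
holomorphic there. -/
theorem IsAdmissible.differentiableOn_momentum {V : ℝ → ℝ} (hV : IsAdmissible V) {M : Set ℂ}
    (hM : IsCompact M) {f : ℂ → ℂ} (hf : AlmostSmooth M f)
    (hcrit : ∀ h : ℂ → ℂ, IsVariation (reg M f ∩ interior M) h →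
      HasDerivAt (energyAlong V M f h) 0 0) :
    DifferentiableOn ℂ (momentum V f) (reg M f ∩ interior M) := by
  set O := reg M f ∩ interior M with hOdef
  have hO : IsOpen O := isOpen_reg_inter_interior hf
  have hφ := contDiffOn_momentum hV M f
  have hzero : ∀ h : ℂ → ℂ, IsVariation O h →
      ∫ z, (conj (h z) * wirtBar (momentum V f) z).re = 0 := by
    intro h hh
    obtain ⟨δ, hδ, h1, -⟩ := hV.hasDerivAt_energyAlong hM hf hh
    have h2 := (h1 0 ⟨by linarith, hδ⟩).unique (hcrit h hh)
    rw [integral_potentialDeriv_eq_integral_momentum (hh.2.2.trans inter_subset_right)] at h2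
    obtain ⟨D, hD⟩ := hh.1.lipschitzWith_of_hasCompactSupport hh.2.1 (by simp)
    rw [integral_re_conj_mul_wirt_of_contDiffOn hO (hφ.of_le (by simp)) hD hh.2.1 hh.2.2] at h2
    linarith
  have hcont : ContinuousOn (wirtBar (momentum V f)) O := by
    have h1 : ContinuousOn (fderiv ℝ (momentum V f)) O :=
      hφ.continuousOn_fderiv_of_isOpen hO (by simp)
    unfold wirtBar
    exact ((h1.clm_apply continuousOn_const).add
      (continuousOn_const.mul (h1.clm_apply continuousOn_const))).div_const _
  have hre : ContinuousOn (fun z => (wirtBar (momentum V f) z).re) O :=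
    Complex.continuous_re.comp_continuousOn hcont
  have him : ContinuousOn (fun z => (wirtBar (momentum V f) z).im) O :=
    Complex.continuous_im.comp_continuousOn hcont
  -- Testing with `g` and with `i g` isolates the real and imaginary parts of `φ_z̄`; the
  -- fundamental lemma of the calculus of variations makes each vanish.
  have hvar : ∀ (c : ℂ) (g : ℂ → ℝ), ContDiff ℝ ∞ g → HasCompactSupport g → tsupport g ⊆ O →
      IsVariation O (fun z => (g z : ℂ) * c) := by
    intro c g hg h'g hgO
    have hg' : ContDiff ℝ ∞ (fun z => (g z : ℂ)) := Complex.ofRealCLM.contDiff.comp hg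
    have hs : HasCompactSupport (fun z => (g z : ℂ)) := h'g.comp_left (g := Complex.ofReal) rfl
    refine ⟨hg'.mul contDiff_const, hs.mul_right, ?_⟩
    refine Subset.trans (closure_mono fun z hz => ?_) hgO
    simp only [Function.mem_support, ne_eq] at hz ⊢
    intro h
    exact hz (by simp [h])
  have hrez : EqOn (fun z => (wirtBar (momentum V f) z).re) (fun _ => 0) O := by
    refine Measure.eqOn_open_of_ae_eq (μ := volume) ?_ hO hre continuousOn_const
    refine (ae_restrict_iff' hO.measurableSet).2 ?_
    refine hO.ae_eq_zero_of_integral_contDiff_smul_eq_zero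
      (hre.locallyIntegrableOn hO.measurableSet) fun g hg h'g hgO => ?_
    rw [← hzero _ (hvar 1 g hg h'g hgO)]
    simp
  have himz : EqOn (fun z => (wirtBar (momentum V f) z).im) (fun _ => 0) O := by
    refine Measure.eqOn_open_of_ae_eq (μ := volume) ?_ hO him continuousOn_const
    refine (ae_restrict_iff' hO.measurableSet).2 ?_
    refine hO.ae_eq_zero_of_integral_contDiff_smul_eq_zero
      (him.locallyIntegrableOn hO.measurableSet) fun g hg h'g hgO => ?_
    rw [← hzero _ (hvar Complex.I g hg h'g hgO)]
    simp
  intro z hz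
  have hbar : wirtBar (momentum V f) z = 0 := Complex.ext (hrez hz) (himz hz)
  refine (differentiableAt_complex_iff_differentiableAt_real.2
    ⟨(hφ.contDiffAt (hO.mem_nhds hz)).differentiableAt (by simp), ?_⟩).differentiableWithinAt
  rw [wirtBar, div_eq_zero_iff, or_iff_left two_ne_zero, add_eq_zero_iff_eq_neg] at hbar
  rw [smul_eq_mul, hbar, mul_neg, ← mul_assoc, Complex.I_mul_I]
  ring

/-- With `x = |w|²`, the bound on `V'(x)√x` is a bound on `|V'(|w|²)| |w|` for small `w`;
compactness handles `η ≤ |w|² ≤ C²`. Through this bound the singularities of the momentum become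
removable. -/
theorem IsAdmissible.exists_norm_momentum_le {V : ℝ → ℝ} (hV : IsAdmissible V) (C : ℝ) :
    ∃ B : ℝ, ∀ w : ℂ, w ≠ 0 → ‖w‖ ≤ C → |1 + deriv V (‖w‖ ^ 2)| * ‖w‖ ≤ B := by
  obtain ⟨c, hc⟩ := hV.deriv_mul_sqrt_bounded.bound
  obtain ⟨η, hη, hηc⟩ := mem_nhdsGT_iff_exists_Ioo_subset.1 hc
  have hη : 0 < η := hη
  obtain ⟨B, hB⟩ := (isCompact_Icc (a := η) (b := C ^ 2)).exists_bound_of_continuousOn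
    (hV.contDiffOn_deriv.continuousOn.mono fun x hx => hη.trans_le hx.1)
  refine ⟨C + |c| + |B| * C, fun w hw hwC => ?_⟩
  have hw0 : 0 < ‖w‖ := norm_pos_iff.2 hw
  have h1 : |1 + deriv V (‖w‖ ^ 2)| * ‖w‖ ≤ ‖w‖ + |deriv V (‖w‖ ^ 2)| * ‖w‖ := by
    have := abs_add_le 1 (deriv V (‖w‖ ^ 2))
    rw [abs_one] at this
    nlinarith
  rcases lt_or_ge (‖w‖ ^ 2) η with h | h
  · have h2 : ‖deriv V (‖w‖ ^ 2) * √(‖w‖ ^ 2)‖ ≤ c * ‖(1 : ℝ)‖ :=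
      hηc ⟨by positivity, h⟩
    rw [Real.sqrt_sq hw0.le, norm_mul, norm_norm, Real.norm_eq_abs, norm_one, mul_one] at h2
    have : 0 ≤ |B| * C := mul_nonneg (abs_nonneg _) (hw0.le.trans hwC)
    linarith [le_abs_self c]
  · have h2 : |deriv V (‖w‖ ^ 2)| ≤ B := hB _ ⟨h, by gcongr⟩
    have h3 : |deriv V (‖w‖ ^ 2)| * ‖w‖ ≤ |B| * C :=
      mul_le_mul (h2.trans (le_abs_self B)) hwC hw0.le (abs_nonneg _)
    linarith [abs_nonneg c]

/-- Riemann's removable singularity theorem for finitely many singularities. -/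
theorem exists_holomorphic_extension {S : Set ℂ} (hS : S.Finite) {Ω : Set ℂ} (hΩ : IsOpen Ω)
    {φ : ℂ → ℂ} (hφ : DifferentiableOn ℂ φ (Ω \ S)) (hB : ∃ B, ∀ z ∈ Ω \ S, ‖φ z‖ ≤ B) :
    ∃ Φ : ℂ → ℂ, DifferentiableOn ℂ Φ Ω ∧ EqOn Φ φ (Ω \ S) ∧ ∃ B, ∀ z ∈ Ω, ‖Φ z‖ ≤ B := by
  induction S, hS using Set.Finite.induction_on generalizing φ with
  | empty => exact ⟨φ, by simpa using hφ, fun _ _ => rfl, by simpa using hB⟩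
  | @insert c S _ hS ih =>
    obtain ⟨B, hB⟩ := hB
    by_cases hc : c ∈ Ω \ S
    · have hopen : Ω \ S ∈ 𝓝 c := (hΩ.sdiff hS.isClosed).mem_nhds hc
      have e : Ω \ insert c S = (Ω \ S) \ {c} := by
        rw [sdiff_sdiff, union_singleton]
      rw [e] at hφ hB ⊢
      set ψ := Function.update φ c (limUnder (𝓝[≠] c) φ) with hψ
      have h1 : DifferentiableOn ℂ ψ (Ω \ S) :=
        Complex.differentiableOn_update_limUnder_of_bddAbove hopen hφ
          ⟨B, by rintro _ ⟨z, hz, rfl⟩; exact hB z hz⟩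
      obtain ⟨Φ, h2, h3, h4⟩ := ih h1 ⟨max B ‖ψ c‖, fun z hz => by
        by_cases hzc : z = c
        · rw [hzc]; exact le_max_right _ _
        · rw [hψ, Function.update_of_ne hzc]
          exact (hB z ⟨hz, hzc⟩).trans (le_max_left _ _)⟩
      refine ⟨Φ, h2, fun z hz => ?_, h4⟩
      rw [h3 hz.1, hψ, Function.update_of_ne hz.2]
    · have e : Ω \ insert c S = Ω \ S := by
        ext z
        simp only [Set.mem_sdiff, mem_insert_iff, not_or]
        refine ⟨fun h => ⟨h.1, h.2.2⟩, fun h => ⟨h.1, fun hz => hc (hz ▸ h), h.2⟩⟩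
      rw [e] at hφ hB ⊢
      exact ih hφ ⟨B, hB⟩

theorem finite_interior_sdiff_reg {M : Set ℂ} {f : ℂ → ℂ} (hf : AlmostImmersed M f) :
    (interior M \ reg M f).Finite :=
  hf.2.subset (sdiff_subset_sdiff_left interior_subset)

/-- The momentum of a weak critical point extends to a bounded holomorphic function. -/
theorem IsWeakCriticalPoint.exists_holomorphic {V : ℝ → ℝ} (hV : IsAdmissible V) {M : Set ℂ}
    (hM : IsCompact M) {f : ℂ → ℂ} (hf : AlmostSmooth M f) (hcrit : IsWeakCriticalPoint V M f) :
    ∃ Φ : ℂ → ℂ, DifferentiableOn ℂ Φ (interior M) ∧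
      EqOn Φ (momentum V f) (reg M f ∩ interior M) ∧ ∃ B, ∀ z ∈ interior M, ‖Φ z‖ ≤ B := by
  have h := hV.differentiableOn_momentum hM hf hcrit.2
  have e : reg M f ∩ interior M = interior M \ (interior M \ reg M f) := by
    rw [sdiff_sdiff_right_self, inter_comm]
  obtain ⟨⟨C, hC⟩, -⟩ := hf
  obtain ⟨B, hB⟩ := hV.exists_norm_momentum_le C
  have hbd : ∀ z ∈ reg M f ∩ interior M, ‖momentum V f z‖ ≤ B := fun z hz => by
    rw [momentum, norm_mul, Complex.norm_real, Real.norm_eq_abs]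
    exact hB _ (wirt_ne_zero_of_mem_reg hz) (norm_wirt_le_of_lipschitzOnWith hC hz.2)
  rw [e] at h hbd ⊢
  exact exists_holomorphic_extension (finite_interior_sdiff_reg hcrit.1) isOpen_interior h
    ⟨B, hbd⟩

theorem ae_mem_reg {M : Set ℂ} {f : ℂ → ℂ} (hf : AlmostImmersed M f) :
    ∀ᵐ z ∂volume.restrict (interior M), z ∈ reg M f ∩ interior M := by
  have h : ∀ᵐ z : ℂ, z ∉ interior M \ reg M f :=
    measure_eq_zero_iff_ae_notMem.1 ((finite_interior_sdiff_reg hf).measure_zero volume)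
  filter_upwards [ae_restrict_of_ae h, ae_restrict_mem isOpen_interior.measurableSet] with z h1 h2
  exact ⟨by_contra fun h3 => h1 ⟨h2, h3⟩, h2⟩

/-! ### Energy excess and minimality -/

theorem wirt_eq_sub_ae {M : Set ℂ} {f f' H : ℂ → ℂ} {C D : ℝ≥0} (hf : LipschitzOnWith C f M)
    (hH : LipschitzWith D H) (hHf : ∀ z ∈ M, H z = f' z - f z) :
    ∀ᵐ z ∂volume.restrict (interior M), wirt H z = wirt f' z - wirt f z := by
  filter_upwards [ae_differentiableAt_of_lipschitzOnWith hf,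
    ae_restrict_of_ae (hH.ae_differentiableAt (μ := volume)),
    ae_restrict_mem isOpen_interior.measurableSet] with z h1 h2 hz
  have : f' =ᶠ[𝓝 z] fun w => f w + H w := by
    filter_upwards [mem_interior_iff_mem_nhds.1 hz] with w hw
    rw [hHf w hw]; ring
  rw [wirt_congr this, wirt_add h1 h2]
  ring

/-- For a stable weak critical point, the energy excess of a competitor with the same boundary
values dominates a nonnegative quadratic expression. -/
theorem IsWeakCriticalPoint.exists_energy_excess {V : ℝ → ℝ} (hV : IsAdmissible V) {M : Set ℂ}
    (hM : IsCompact M) {f f' : ℂ → ℂ} (hf : AlmostSmooth M f) (hcrit : IsWeakCriticalPoint V M f)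
    (hf' : AlmostSmooth M f') (h : EqOn f' f (frontier M)) :
    ∃ D : ℂ → ℝ, Integrable D (volume.restrict (interior M)) ∧
      1 / 2 * ∫ z in interior M, D z = energy V M f' - energy V M f ∧
      ∀ᵐ z ∂volume.restrict (interior M),
        (1 + deriv V (‖wirt f z‖ ^ 2)) * ‖wirt f' z - wirt f z‖ ^ 2 ≤ D z := by
  obtain ⟨Φ, hΦ, hΦeq, B, hB⟩ := hcrit.exists_holomorphic hV hM hf
  obtain ⟨⟨C, hC⟩, -⟩ := hf
  obtain ⟨⟨C', hC'⟩, -⟩ := hf'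
  obtain ⟨H, L, hH, h'H, hH0, hHf⟩ := exists_lipschitzWith_sub hM hC hC' h
  have hfin := isFiniteMeasure_restrict_interior hM
  have hvol : volume (interior M) ≠ ⊤ :=
    ((measure_mono interior_subset).trans_lt hM.measure_lt_top).ne
  have horth := integral_re_conj_mul_wirt_eq_zero isOpen_interior hvol hΦ hB hH h'H hH0
  have hwH := wirt_eq_sub_ae hC hH hHf
  have hint : Integrable (fun z => (conj (Φ z) * wirt H z).re)
      (volume.restrict (interior M)) := by
    refine Integrable.of_bound ?_ (B * L) ?_
    · exact Complex.continuous_re.comp_aestronglyMeasurable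
        ((Complex.continuous_conj.comp_aestronglyMeasurable
          (hΦ.continuousOn.aestronglyMeasurable isOpen_interior.measurableSet)).mul
          (measurable_wirt _).aestronglyMeasurable)
    · filter_upwards [ae_restrict_mem isOpen_interior.measurableSet] with z hz
      rw [Real.norm_eq_abs]
      refine (Complex.abs_re_le_norm _).trans ?_
      rw [norm_mul, RCLike.norm_conj]
      exact mul_le_mul (hB z hz)
        ((norm_wirt_le _ _).trans (norm_fderiv_le_of_lipschitz ℝ hH))
        (norm_nonneg _) ((norm_nonneg _).trans (hB z hz))
  have hp := hV.integrable_potential_wirt hM hC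
  have hp' := hV.integrable_potential_wirt hM hC'
  -- The subtracted term is the linear part of the potential at `f_z`. It integrates to zero because
  -- `Φ` is holomorphic and bounded, so the energy difference is unaffected, and what remains
  -- pointwise dominates the quadratic remainder in `potential_ge`.
  refine ⟨fun z => potential V (wirt f' z) - potential V (wirt f z) -
    2 * (conj (Φ z) * wirt H z).re, (hp'.sub' hp).sub' (hint.const_mul 2), ?_, ?_⟩
  · rw [hV.energy_sub_energy hM hC hC' h, integral_sub (hp'.sub' hp) (hint.const_mul 2),
      integral_sub hp' hp, integral_const_mul, horth]
    ring
  · filter_upwards [hwH, ae_mem_reg hcrit.1] with z h1 h2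
    have h3 := hV.potential_ge (wirt_ne_zero_of_mem_reg h2) (wirt f' z)
    rw [potentialDeriv_eq, ← hΦeq h2, ← h1] at h3
    rw [← h1]
    linarith

theorem ae_stable {V : ℝ → ℝ} {M : Set ℂ} {f : ℂ → ℂ} (hf : AlmostImmersed M f)
    (hS : IsStable V M f) :
    ∀ᵐ z ∂volume.restrict (interior M), 0 ≤ 1 + deriv V (‖wirt f z‖ ^ 2) := by
  filter_upwards [ae_mem_reg hf] with z hz
  have := hS z hz
  rwa [dz_eq_wirt hz.2] at this

theorem IsWeakCriticalPoint.isMinimizer {V : ℝ → ℝ} (hV : IsAdmissible V) {M : Set ℂ}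
    (hM : IsCompact M) {f : ℂ → ℂ} (hf : AlmostSmooth M f) (hcrit : IsWeakCriticalPoint V M f)
    (hS : IsStable V M f) : IsMinimizer V M f := by
  refine ⟨hf, fun f' hf' h => ?_⟩
  obtain ⟨D, -, hD, hle⟩ := hcrit.exists_energy_excess hV hM hf hf' h
  have : 0 ≤ ∫ z in interior M, D z := by
    refine integral_nonneg_of_ae ?_
    filter_upwards [hle, ae_stable hcrit.1 hS] with z h1 h2
    exact (mul_nonneg h2 (sq_nonneg _)).trans h1
  linarith

/-! ### Strict minimality -/

/-- A compactly supported Lipschitz function whose derivative in direction `1` vanishes almost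
everywhere is zero. -/
theorem eq_zero_of_lineDeriv_ae_eq_zero {u : ℂ → ℝ} {D : ℝ≥0} (hu : LipschitzWith D u)
    (h'u : HasCompactSupport u) (h0 : ∀ᵐ z, lineDeriv ℝ u z 1 = 0) (z : ℂ) : u z = 0 := by
  obtain ⟨B, hB⟩ := h'u.exists_bound_of_continuous hu.continuous
  have hB0 : 0 ≤ B := (norm_nonneg _).trans (hB 0)
  have hsq : LipschitzWith (2 * B.toNNReal * D) (fun z => u z * u z) := by
    refine LipschitzWith.of_dist_le_mul fun x y => ?_
    have h1 := hu.dist_le_mul x y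
    have h2 := hB x
    have h3 := hB y
    rw [Real.dist_eq] at h1 ⊢
    rw [Real.norm_eq_abs] at h2 h3
    have e : u x * u x - u y * u y = (u x + u y) * (u x - u y) := by ring
    rw [e, abs_mul]
    push_cast
    rw [Real.coe_toNNReal B hB0, mul_assoc]
    refine mul_le_mul ?_ h1 (abs_nonneg _) (by positivity)
    exact (abs_add_le _ _).trans (by linarith)
  have h'sq : HasCompactSupport (fun z => u z * u z) := h'u.mul_right
  -- Write `1 = ∂x/∂x` and integrate by parts: the integral of `u²` is minus that of `x ∂(u²)/∂x`,
  -- which is zero. This avoids slicing the plane into lines.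
  have key := (lipschitzWith_re LipschitzWith.id).integral_lineDeriv_mul_eq (μ := volume)
    hsq h'sq 1
  have e1 : ∀ z : ℂ, lineDeriv ℝ (fun x : ℂ => (id x).re) z 1 = 1 := fun z => by
    have := (Complex.reCLM.hasFDerivAt (x := z)).hasLineDerivAt 1
    exact this.lineDeriv.trans (by simp)
  have e2 : ∀ᵐ z : ℂ, lineDeriv ℝ (fun z => u z * u z) z (-1) = 0 := by
    filter_upwards [h0, hu.ae_lineDifferentiableAt (μ := volume) 1] with z hz hd
    have h1 := hd.hasLineDerivAt
    rw [hz] at h1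
    rw [lineDeriv_neg, neg_eq_zero]
    refine HasLineDerivAt.lineDeriv ?_
    simp only [HasLineDerivAt] at h1 ⊢
    exact (h1.fun_mul h1).congr_deriv (by simp)
  have e3 : ∫ z : ℂ, lineDeriv ℝ (fun z => u z * u z) z (-1) * (id z).re = 0 := by
    refine integral_eq_zero_of_ae ?_
    filter_upwards [e2] with z hz
    simp [hz]
  simp only [e1, one_mul] at key
  rw [e3] at key
  by_contra hz
  have := (hu.continuous.mul hu.continuous).integral_pos_of_hasCompactSupport_nonneg_nonzero
    (μ := volume) h'sq (fun z => mul_self_nonneg _) (mul_ne_zero hz hz)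
  exact this.ne' key

/-- A compactly supported Lipschitz map whose `z`-derivative vanishes almost everywhere is zero. -/
theorem eq_zero_of_wirt_ae_eq_zero {H : ℂ → ℂ} {D : ℝ≥0} (hH : LipschitzWith D H)
    (h'H : HasCompactSupport H) (h0 : ∀ᵐ z, wirt H z = 0) (z : ℂ) : H z = 0 := by
  -- With `F = 0` the null Lagrangian identity says that `H_z` and `H_z̄` have the same `L²` norm.
  have hjac := integral_jacobian_add_sub_eq_zero (LipschitzWith.const (0 : ℂ)) hH h'H
  have hint : Integrable (fun z => ‖wirtBar H z‖ ^ 2) := by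
    refine (integrableOn_iff_integrable_of_support_subset (s := tsupport H) ?_).1 ?_
    · intro z hz
      by_contra h
      exact hz (by simp [wirtBar_eq_zero_of_fderiv (fderiv_eq_zero_of_notMem_tsupport h)])
    · have : IsFiniteMeasure (volume.restrict (tsupport H)) :=
        ⟨by simpa using h'H.measure_lt_top⟩
      exact integrable_comp_of_norm_le (Φ := fun w => ‖w‖ ^ 2) (by fun_prop)
        (measurable_wirtBar H) (C := D) (Eventually.of_forall fun z =>
          (norm_wirtBar_le _ _).trans (norm_fderiv_le_of_lipschitz ℝ hH))
  have hwb : ∀ᵐ z, wirtBar H z = 0 := by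
    have e : ∫ z, ‖wirtBar H z‖ ^ 2 = 0 := by
      rw [← neg_eq_zero, ← integral_neg, ← hjac]
      refine integral_congr_ae ?_
      filter_upwards [h0] with z hz
      simp only [zero_add]
      rw [show wirt (fun w => H w) z = 0 from hz]
      simp [wirt, wirtBar]
    filter_upwards [(integral_eq_zero_iff_of_nonneg (fun z => sq_nonneg _) hint).1 e] with z hz
    simpa using hz
  have hd : ∀ᵐ z, fderiv ℝ H z 1 = 0 := by
    filter_upwards [h0, hwb] with z h1 h2
    have : fderiv ℝ H z 1 = wirt H z + wirtBar H z := by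
      rw [wirt, wirtBar]; ring
    rw [this, h1, h2, add_zero]
  have hd' : ∀ᵐ z, lineDeriv ℝ (fun x => (H x).re) z 1 = 0 ∧
      lineDeriv ℝ (fun x => (H x).im) z 1 = 0 := by
    filter_upwards [hd, hH.ae_differentiableAt (μ := volume)] with z h1 h2
    rw [fderiv_eq_lineDeriv_re_add_im h2] at h1
    exact ⟨by simpa using congrArg Complex.re h1, by simpa using congrArg Complex.im h1⟩
  refine Complex.ext ?_ ?_
  · exact eq_zero_of_lineDeriv_ae_eq_zero (lipschitzWith_re hH)
      (h'H.comp_left (g := Complex.re) rfl) (hd'.mono fun _ h => h.1) z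
  · exact eq_zero_of_lineDeriv_ae_eq_zero (lipschitzWith_im hH)
      (h'H.comp_left (g := Complex.im) rfl) (hd'.mono fun _ h => h.2) z

/-- Equality of energies makes the nonnegative excess density vanish almost everywhere. By the
identity theorem on the connected interior, `Φ` is nonzero off a null set, so `1 + V'(|f_z|²) > 0`
almost everywhere, and the difference of the maps has vanishing `z`-derivative. -/
theorem IsWeakCriticalPoint.isStrictMinimizer {V : ℝ → ℝ} (hV : IsAdmissible V) {M : Set ℂ}
    (hM : IsPiecewiseSmoothDomain M) {f : ℂ → ℂ} (hf : AlmostSmooth M f)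
    (hcrit : IsWeakCriticalPoint V M f) (hS : IsStable V M f)
    (hne : ∃ z ∈ reg M f ∩ interior M, 1 + deriv V (‖dz M f z‖ ^ 2) ≠ 0) :
    IsStrictMinimizer V M f := by
  refine ⟨hf, fun f' hf' h hff' => ?_⟩
  have hMc := hM.isCompact
  refine lt_of_le_of_ne ((hcrit.isMinimizer hV hMc hf hS).2 f' hf' h) fun heq => hff' ?_
  obtain ⟨D, hDi, hD, hle⟩ := hcrit.exists_energy_excess hV hMc hf hf' h
  obtain ⟨Φ, hΦ, hΦeq, -⟩ := hcrit.exists_holomorphic hV hMc hf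
  have hst := ae_stable hcrit.1 hS
  have hD0 : ∀ᵐ z ∂volume.restrict (interior M), D z = 0 := by
    have hnn : 0 ≤ᵐ[volume.restrict (interior M)] D := by
      filter_upwards [hle, hst] with z h1 h2
      exact (mul_nonneg h2 (sq_nonneg _)).trans h1
    refine (integral_eq_zero_iff_of_nonneg_ae hnn hDi).1 ?_
    linarith
  have hΦ0 : ∀ᵐ z ∂volume.restrict (interior M), Φ z ≠ 0 := by
    obtain ⟨z₀, hz₀, hne⟩ := hne
    rw [dz_eq_wirt hz₀.2] at hne
    have hz₀' : Φ z₀ ≠ 0 := by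
      rw [hΦeq hz₀, momentum]
      exact mul_ne_zero (Complex.ofReal_ne_zero.2 hne) (wirt_ne_zero_of_mem_reg hz₀)
    have han : AnalyticOnNhd ℂ Φ (interior M) := hΦ.analyticOnNhd isOpen_interior
    rcases han.eqOn_zero_or_eventually_ne_zero_of_preconnected
      hM.isConnected_interior.isPreconnected with h1 | h1
    · exact absurd (h1 hz₀.2) hz₀'
    · exact ae_restrict_le_codiscreteWithin isOpen_interior.measurableSet h1
  have hw : ∀ᵐ z ∂volume.restrict (interior M), wirt f' z - wirt f z = 0 := by
    filter_upwards [hle, hD0, hΦ0, hst, ae_mem_reg hcrit.1] with z h1 h2 h3 h4 h5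
    have h6 : 1 + deriv V (‖wirt f z‖ ^ 2) ≠ 0 := by
      intro h
      rw [hΦeq h5, momentum, h] at h3
      simp at h3
    rw [h2] at h1
    by_contra h7
    have h8 : 0 < 1 + deriv V (‖wirt f z‖ ^ 2) := lt_of_le_of_ne h4 h6.symm
    have h9 : 0 < ‖wirt f' z - wirt f z‖ := norm_pos_iff.2 h7
    have : 0 < (1 + deriv V (‖wirt f z‖ ^ 2)) * ‖wirt f' z - wirt f z‖ ^ 2 := by positivity
    linarith
  obtain ⟨⟨C, hC⟩, -⟩ := hf
  obtain ⟨⟨C', hC'⟩, -⟩ := hf'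
  obtain ⟨H, L, hH, h'H, hH0, hHf⟩ := exists_lipschitzWith_sub hMc hC hC' h
  have hwH : ∀ᵐ z, wirt H z = 0 := by
    have h1 : ∀ᵐ z ∂volume.restrict (interior M), wirt H z = 0 := by
      filter_upwards [wirt_eq_sub_ae hC hH hHf, hw] with z h1 h2
      rw [h1, h2]
    rw [ae_restrict_iff' isOpen_interior.measurableSet] at h1
    filter_upwards [h1, ae_fderiv_eq_zero_of_eq_zero (μ := volume) hH] with z h2 h3
    by_cases hz : z ∈ interior M
    · exact h2 hz
    · exact wirt_eq_zero_of_fderiv (h3 (hH0 z hz))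
  intro z hz
  rw [← sub_eq_zero, ← hHf z hz]
  exact eq_zero_of_wirt_ae_eq_zero hH h'H hwH z

/-! ### Instability where `1 + V'(|f_z|²)` is negative -/

/-- The `z`-derivative of a complex multiple of a real function. -/
theorem wirt_ofReal_mul {ψ : ℂ → ℝ} {z : ℂ} (hψ : DifferentiableAt ℝ ψ z) (c : ℂ) :
    wirt (fun w => c * (ψ w : ℂ)) z =
      c * (((fderiv ℝ ψ z 1 : ℝ) : ℂ) - Complex.I * ((fderiv ℝ ψ z Complex.I : ℝ) : ℂ)) / 2 := by
  have h1 : HasFDerivAt (fun w => (ψ w : ℂ)) (Complex.ofRealCLM.comp (fderiv ℝ ψ z)) z :=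
    Complex.ofRealCLM.hasFDerivAt.comp z hψ.hasFDerivAt
  rw [wirt_const_mul h1.differentiableAt, wirt, h1.fderiv]
  simp [mul_div_assoc]

/-- Modulating a cutoff function `χ` by `cos (l x)` and by `sin (l x)`, the sum of the resulting
second derivatives of the potential splits off a term quadratic in the frequency `l`. -/
theorem potentialDeriv₂_cos_add_sin (V : ℝ → ℝ) (w c : ℂ) {χ : ℂ → ℝ} {z : ℂ}
    (hχ : DifferentiableAt ℝ χ z) (l : ℝ) :
    potentialDeriv₂ V w (wirt (fun w => c * ((Real.cos (l * w.re) * χ w : ℝ) : ℂ)) z) +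
      potentialDeriv₂ V w (wirt (fun w => c * ((Real.sin (l * w.re) * χ w : ℝ) : ℂ)) z) =
    l ^ 2 / 4 * (χ z ^ 2 * potentialDeriv₂ V w c) +
      potentialDeriv₂ V w (wirt (fun w => c * (χ w : ℂ)) z) := by
  have hre : HasFDerivAt (fun w : ℂ => l * w.re) (l • Complex.reCLM) z :=
    Complex.reCLM.hasFDerivAt.const_mul l
  have hc := hre.cos.fun_mul hχ.hasFDerivAt
  have hs := hre.sin.fun_mul hχ.hasFDerivAt
  rw [wirt_ofReal_mul hc.differentiableAt, wirt_ofReal_mul hs.differentiableAt,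
    wirt_ofReal_mul hχ, hc.fderiv, hs.fderiv]
  have hcs := Real.sin_sq_add_cos_sq (l * z.re)
  -- Multiplying the right side by `sin² + cos²` turns the claim into a polynomial identity in
  -- independent variables.
  refine Eq.trans ?_ ((congrArg (_ * ·) hcs).trans (mul_one _))
  generalize Real.cos (l * z.re) = C at *
  generalize Real.sin (l * z.re) = S at *
  simp only [add_apply, smul_apply, Complex.reCLM_apply, smul_eq_mul,
    Complex.one_re, Complex.I_re, mul_one, mul_zero, add_zero]
  generalize fderiv ℝ χ z 1 = X
  generalize fderiv ℝ χ z Complex.I = Y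
  generalize χ z = k
  simp only [potentialDeriv₂, ← Complex.normSq_eq_norm_sq, Complex.normSq_apply,
    Complex.div_ofNat_re, Complex.div_ofNat_im, Complex.mul_re, Complex.mul_im, Complex.sub_re,
    Complex.sub_im, Complex.ofReal_re, Complex.ofReal_im, Complex.I_re, Complex.I_im,
    Complex.conj_re, Complex.conj_im]
  generalize 1 + deriv V (w.re * w.re + w.im * w.im) = A
  generalize deriv (deriv V) (w.re * w.re + w.im * w.im) = B
  generalize w.re = w1
  generalize w.im = w2
  generalize c.re = c1
  generalize c.im = c2
  ring

/-- A point of a regular open set where `1 + V'(|f_z|²)` is negative carries localized variations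
with negative second variation. -/
theorem IsAdmissible.exists_variation_neg {V : ℝ → ℝ} (hV : IsAdmissible V) {M : Set ℂ}
    {f : ℂ → ℂ} (hf : AlmostSmooth M f) {p : ℂ} (hp : p ∈ reg M f ∩ interior M)
    (hneg : 1 + deriv V (‖wirt f p‖ ^ 2) < 0) {U : Set ℂ} (hU : U ∈ 𝓝 p) :
    ∃ h : ℂ → ℂ, IsVariation (U ∩ (reg M f ∩ interior M)) h ∧
      ∫ z in interior M, potentialDeriv₂ V (wirt f z) (wirt h z) < 0 := by
  set O := reg M f ∩ interior M with hOdef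
  have hO : IsOpen O := isOpen_reg_inter_interior hf
  -- This direction is tangent to the circle through `f_z(p)`, so `Re(conj f_z(p) · c) = 0`: the
  -- nonnegative `V''` term drops out at `p` and only `2(1 + V')|c|² < 0` is left.
  set c := Complex.I * wirt f p with hc
  have hcont : ∀ g : ℂ → ℂ, ContinuousOn g O →
      ContinuousOn (fun z => potentialDeriv₂ V (wirt f z) (g z)) O := by
    intro g hg
    have hw := continuousOn_wirt_reg M f
    have hmem : ∀ z ∈ O, ‖wirt f z‖ ^ 2 ∈ Ioi (0 : ℝ) := fun z hz => by
      have := norm_pos_iff.2 (wirt_ne_zero_of_mem_reg hz)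
      exact mem_Ioi.2 (by positivity)
    have hV1 := hV.contDiffOn_deriv.continuousOn.comp (hw.norm.pow 2) hmem
    have hV2 := hV.continuousOn_deriv_deriv.comp (hw.norm.pow 2) hmem
    have hre : ContinuousOn (fun z => (conj (wirt f z) * g z).re) O :=
      Complex.continuous_re.comp_continuousOn ((Complex.continuous_conj.comp_continuousOn hw).mul hg)
    exact ((continuousOn_const.mul (continuousOn_const.add hV1)).mul (hg.norm.pow 2)).add
      ((continuousOn_const.mul hV2).mul (hre.pow 2))
  set q : ℂ → ℝ := fun z => potentialDeriv₂ V (wirt f z) c with hq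
  have hqc : ContinuousOn q O := hcont (fun _ => c) continuousOn_const
  have hqp : q p < 0 := by
    have h1 : (conj (wirt f p) * c).re = 0 := by
      simp [hc, Complex.mul_re]; ring
    have h2 : 0 < ‖c‖ ^ 2 := by
      have : 0 < ‖c‖ := norm_pos_iff.2 (mul_ne_zero Complex.I_ne_zero (wirt_ne_zero_of_mem_reg hp))
      positivity
    simp only [hq, potentialDeriv₂, h1]
    nlinarith
  have hW : {z | q z < q p / 2} ∩ (U ∩ O) ∈ 𝓝 p :=
    inter_mem ((hqc.continuousAt (hO.mem_nhds hp)).eventually (gt_mem_nhds (by linarith)))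
      (inter_mem hU (hO.mem_nhds hp))
  obtain ⟨χ, hχW, h'χ, hχ, -, hχp⟩ := exists_contDiff_tsupport_subset (n := ⊤) hW
  have hχO : tsupport χ ⊆ O := hχW.trans (inter_subset_right.trans inter_subset_right)
  have hχd : ∀ z, DifferentiableAt ℝ χ z := fun z => hχ.contDiffAt.differentiableAt (by simp)
  have hvar : ∀ g : ℂ → ℝ, ContDiff ℝ ∞ g →
      IsVariation (U ∩ O) (fun w => c * ((g w * χ w : ℝ) : ℂ)) := by
    intro g hg
    have hg' : ContDiff ℝ ∞ (fun z => ((g z * χ z : ℝ) : ℂ)) :=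
      Complex.ofRealCLM.contDiff.comp (hg.mul hχ)
    have hs : tsupport (fun w => c * ((g w * χ w : ℝ) : ℂ)) ⊆ tsupport χ := by
      refine closure_mono fun z hz => ?_
      simp only [Function.mem_support, ne_eq] at hz ⊢
      intro h
      exact hz (by simp [h])
    exact ⟨contDiff_const.mul hg', h'χ.of_isClosed_subset (isClosed_tsupport _) hs,
      hs.trans (hχW.trans inter_subset_right)⟩
  have hint : ∀ g : ℂ → ℝ, ContDiff ℝ ∞ g → Integrable (fun z => potentialDeriv₂ V (wirt f z)
      (wirt (fun w => c * ((g w * χ w : ℝ) : ℂ)) z)) (volume.restrict (interior M)) := by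
    intro g hg
    obtain ⟨h1, h2, h3⟩ := hvar g hg
    refine Integrable.restrict ?_
    refine (integrableOn_iff_integrable_of_support_subset
      (s := tsupport (fun w => c * ((g w * χ w : ℝ) : ℂ))) ?_).1 ?_
    · intro z hz
      by_contra h
      refine hz ?_
      beta_reduce
      rw [wirt_eq_zero_of_fderiv (fderiv_eq_zero_of_notMem_tsupport h)]
      simp [potentialDeriv₂]
    · refine ((hcont _ ?_).mono (h3.trans inter_subset_right)).integrableOn_compact h2
      exact fun z _ => (contDiffAt_wirt h1.contDiffAt).continuousAt.continuousWithinAt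
  have hone := hint (fun _ => 1) contDiff_const
  simp only [one_mul] at hone
  have hχq : Integrable (fun z => χ z ^ 2 * q z) (volume.restrict (interior M)) := by
    refine Integrable.restrict ?_
    refine (integrableOn_iff_integrable_of_support_subset (s := tsupport χ) ?_).1 ?_
    · intro z hz
      by_contra h
      exact hz (by simp [image_eq_zero_of_notMem_tsupport h])
    · exact (((hχ.continuous.pow 2).continuousOn).mul
        (hqc.mono hχO)).integrableOn_compact h'χ
  have hA : ∫ z in interior M, χ z ^ 2 * q z < 0 := by
    have hs : HasCompactSupport (fun z => χ z ^ 2) := h'χ.comp_left (g := fun x => x ^ 2) (by simp)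
    have h1 : 0 < ∫ z, χ z ^ 2 :=
      (hχ.continuous.pow 2).integral_pos_of_hasCompactSupport_nonneg_nonzero hs
        (fun z => sq_nonneg _) (x := p) (by simp [hχp])
    have h2 : ∫ z in interior M, χ z ^ 2 = ∫ z, χ z ^ 2 := by
      refine setIntegral_eq_integral_of_forall_compl_eq_zero fun z hz => ?_
      simp [image_eq_zero_of_notMem_tsupport fun h => hz (hχO h).2]
    have h3 : ∫ z in interior M, χ z ^ 2 * q z ≤ ∫ z in interior M, χ z ^ 2 * (q p / 2) := by
      refine integral_mono hχq (((hχ.continuous.pow 2).integrable_of_hasCompactSupport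
        hs).restrict.mul_const _) fun z => ?_
      by_cases hz : z ∈ tsupport χ
      · exact mul_le_mul_of_nonneg_left (hχW hz).1.le (sq_nonneg _)
      · simp [image_eq_zero_of_notMem_tsupport hz]
    rw [integral_mul_const, h2] at h3
    nlinarith
  set A := ∫ z in interior M, χ z ^ 2 * q z with hAdef
  set B := ∫ z in interior M, potentialDeriv₂ V (wirt f z)
    (wirt (fun w => c * (χ w : ℂ)) z) with hBdef
  -- A high frequency makes the negative term win: `l²/4 = (|B| + 1)/(-A)` turns the sum into `-(|B|
  -- + 1) + B`.
  obtain ⟨l, hl⟩ : ∃ l : ℝ, l ^ 2 / 4 * A + B < 0 := by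
    refine ⟨2 * √((|B| + 1) / -A), ?_⟩
    have h1 : 0 ≤ (|B| + 1) / -A := div_nonneg (by positivity) (by linarith)
    rw [mul_pow, Real.sq_sqrt h1]
    have h2 : (2 : ℝ) ^ 2 * ((|B| + 1) / -A) / 4 * A = -(|B| + 1) := by
      have : A ≠ 0 := hA.ne
      field_simp
      norm_num
    rw [h2]
    linarith [le_abs_self B]
  have hcos : ContDiff ℝ ∞ (fun w : ℂ => Real.cos (l * w.re)) :=
    Real.contDiff_cos.comp (contDiff_const.mul Complex.reCLM.contDiff)
  have hsin : ContDiff ℝ ∞ (fun w : ℂ => Real.sin (l * w.re)) :=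
    Real.contDiff_sin.comp (contDiff_const.mul Complex.reCLM.contDiff)
  have hsum : (∫ z in interior M, potentialDeriv₂ V (wirt f z)
        (wirt (fun w => c * ((Real.cos (l * w.re) * χ w : ℝ) : ℂ)) z)) +
      ∫ z in interior M, potentialDeriv₂ V (wirt f z)
        (wirt (fun w => c * ((Real.sin (l * w.re) * χ w : ℝ) : ℂ)) z) = l ^ 2 / 4 * A + B := by
    rw [← integral_add (hint _ hcos) (hint _ hsin), hAdef, hBdef, ← integral_const_mul,
      ← integral_add (hχq.const_mul _) hone]
    refine integral_congr_ae (Eventually.of_forall fun z => ?_)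
    exact potentialDeriv₂_cos_add_sin V (wirt f z) c (hχd z) l
  -- The cosine and sine variations have negative second variations in sum, hence at least one of
  -- them does.
  by_cases h : ∫ z in interior M, potentialDeriv₂ V (wirt f z)
        (wirt (fun w => c * ((Real.cos (l * w.re) * χ w : ℝ) : ℂ)) z) < 0
  · exact ⟨_, hvar _ hcos, h⟩
  · exact ⟨_, hvar _ hsin, by linarith⟩

/-- A function with vanishing first and negative second derivative at `0` decreases to the right
of `0`. -/
theorem eventually_lt_of_hasDerivAt_deriv_neg {E E' : ℝ → ℝ} {c δ : ℝ} (hδ : 0 < δ)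
    (hE : ∀ t ∈ Ioo (-δ) δ, HasDerivAt E (E' t) t) (h0 : E' 0 = 0) (hE' : HasDerivAt E' c 0)
    (hc : c < 0) : ∀ᶠ t in 𝓝[>] (0 : ℝ), E t < E 0 := by
  have h1 : ∀ᶠ t in 𝓝[>] (0 : ℝ), E' t < 0 := by
    have h2 := (hasDerivAt_iff_tendsto_slope_zero.1 hE').eventually (gt_mem_nhds hc)
    have h3 : 𝓝[>] (0 : ℝ) ≤ 𝓝[≠] 0 := nhdsWithin_mono _ fun x hx => (ne_of_gt hx)
    filter_upwards [h3 h2, self_mem_nhdsWithin] with t ht (htpos : 0 < t)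
    simp only [zero_add, h0, sub_zero, smul_eq_mul] at ht
    by_contra hcon
    exact absurd ht (not_lt.2 (mul_nonneg (inv_nonneg.2 htpos.le) (not_lt.1 hcon)))
  obtain ⟨η, hη, hηE⟩ := mem_nhdsGT_iff_exists_Ioo_subset.1 h1
  filter_upwards [Ioo_mem_nhdsGT (lt_min (show (0 : ℝ) < η from hη) hδ)] with t ht
  have htδ : t < δ := ht.2.trans_le (min_le_right _ _)
  obtain ⟨s, hs, hslope⟩ := exists_hasDerivAt_eq_slope E E' ht.1
    (fun x hx => (hE x ⟨by linarith [hx.1], by linarith [hx.2]⟩).continuousAt.continuousWithinAt)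
    (fun x hx => hE x ⟨by linarith [hx.1], by linarith [hx.2]⟩)
  have h4 : E' s < 0 := hηE ⟨hs.1, hs.2.trans (ht.2.trans_le (min_le_left _ _))⟩
  rw [hslope, div_lt_iff₀ (by linarith [ht.1])] at h4
  linarith

/-- A point where `1 + V'(|f_z|²)` is negative carries localized variations along which the energy
has a negative second derivative and decreases. -/
theorem IsAdmissible.exists_variation_lt {V : ℝ → ℝ} (hV : IsAdmissible V) {M : Set ℂ}
    (hM : IsCompact M) {f : ℂ → ℂ} (hf : AlmostSmooth M f)
    (hcrit : ∀ h : ℂ → ℂ, IsVariation (reg M f ∩ interior M) h →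
      HasDerivAt (energyAlong V M f h) 0 0) {p : ℂ} (hp : p ∈ reg M f ∩ interior M)
    (hneg : 1 + deriv V (‖dz M f p‖ ^ 2) < 0) {U : Set ℂ} (hU : U ∈ 𝓝 p) :
    ∃ h : ℂ → ℂ, IsVariation (U ∩ (reg M f ∩ interior M)) h ∧
      (∃ (E' : ℝ → ℝ) (c : ℝ), (∀ᶠ t in 𝓝 (0 : ℝ), HasDerivAt (energyAlong V M f h) (E' t) t) ∧
        HasDerivAt E' c 0 ∧ c < 0) ∧
      ∀ᶠ t in 𝓝[>] (0 : ℝ), energyAlong V M f h t < energy V M f := by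
  rw [dz_eq_wirt hp.2] at hneg
  obtain ⟨h, hh, hlt⟩ := hV.exists_variation_neg hf hp hneg hU
  have hh' : IsVariation (reg M f ∩ interior M) h :=
    ⟨hh.1, hh.2.1, hh.2.2.trans inter_subset_right⟩
  obtain ⟨δ, hδ, h1, h2⟩ := hV.hasDerivAt_energyAlong hM hf hh'
  have h3 := (h1 0 ⟨by linarith, hδ⟩).unique (hcrit h hh')
  refine ⟨h, hh, ⟨_, _, ?_, h2, by linarith⟩, ?_⟩
  · filter_upwards [Ioo_mem_nhds (neg_lt_zero.2 hδ) hδ] with t ht using h1 t ht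
  · have h4 := eventually_lt_of_hasDerivAt_deriv_neg hδ h1 h3 h2 (by linarith)
    have h5 : energyAlong V M f h 0 = energy V M f := by simp [energyAlong]
    rwa [h5] at h4

/-! ### Necessary conditions for minimizers -/

theorem IsMinimizer.hasDerivAt_zero {V : ℝ → ℝ} (hV : IsAdmissible V) {M : Set ℂ}
    (hM : IsCompact M) {f : ℂ → ℂ} (hf : IsMinimizer V M f) {h : ℂ → ℂ}
    (hh : IsVariation (reg M f ∩ interior M) h) : HasDerivAt (energyAlong V M f h) 0 0 := by
  obtain ⟨δ, hδ, h1, -⟩ := hV.hasDerivAt_energyAlong hM hf.1 hh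
  have h2 := h1 0 ⟨by linarith, hδ⟩
  have hmin : IsLocalMin (energyAlong V M f h) 0 := by
    refine Eventually.of_forall fun t => ?_
    have h5 : energyAlong V M f h 0 = energy V M f := by simp [energyAlong]
    rw [h5]
    exact hf.2 _ (almostSmooth_add_mul hf.1 hh.1 hh.2.1 t)
      (eqOn_frontier_add_mul (hh.2.2.trans inter_subset_right) t)
  rwa [hmin.hasDerivAt_eq_zero h2] at h2

theorem IsMinimizer.isStable {V : ℝ → ℝ} (hV : IsAdmissible V) {M : Set ℂ}
    (hM : IsCompact M) {f : ℂ → ℂ} (hf : IsMinimizer V M f) : IsStable V M f := by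
  intro z hz
  by_contra hneg
  obtain ⟨h, hh, -, hlt⟩ := hV.exists_variation_lt hM hf.1 (fun h hh => hf.hasDerivAt_zero hV hM hh)
    hz (not_le.1 hneg) univ_mem
  obtain ⟨t, ht⟩ := hlt.exists
  refine absurd ht (not_lt.2 ?_)
  exact hf.2 _ (almostSmooth_add_mul hf.1 hh.1 hh.2.1 t)
    (eqOn_frontier_add_mul (hh.2.2.trans (inter_subset_right.trans inter_subset_right)) t)

/-! ### Minimizers are almost immersed -/

/-- A sublevel set of a differentiable function with nonvanishing derivative is a set of unique
differentiability. -/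
theorem uniqueDiffWithinAt_of_sublevel {E : Type*} [NormedAddCommGroup E] [NormedSpace ℝ E]
    {M : Set E} {ρ : E → ℝ} {p : E} (hp : p ∈ M) (hρ : DifferentiableAt ℝ ρ p)
    (hρ0 : fderiv ℝ ρ p ≠ 0) (hM : ∀ᶠ z in 𝓝 p, (z ∈ M ↔ ρ z ≤ 0)) :
    UniqueDiffWithinAt ℝ M p := by
  have hcone : ∀ v, fderiv ℝ ρ p v < 0 → v ∈ tangentConeAt ℝ M p := by
    intro v hv
    have hline := (hρ.hasFDerivAt.hasLineDerivAt v).tendsto_slope_zero_right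
    have h1 : ∀ᶠ t : ℝ in 𝓝[>] 0, t⁻¹ • (ρ (p + t • v) - ρ p) < 0 :=
      hline.eventually (gt_mem_nhds hv)
    have h2 : Tendsto (fun t : ℝ => p + t • v) (𝓝[>] 0) (𝓝 p) := by
      have : Tendsto (fun t : ℝ => p + t • v) (𝓝 0) (𝓝 (p + (0 : ℝ) • v)) :=
        Continuous.tendsto (by fun_prop) 0
      rw [zero_smul, add_zero] at this
      exact this.mono_left nhdsWithin_le_nhds
    refine mem_tangentConeAt_of_add_smul_mem (l := 𝓝[>] (0 : ℝ)) (c := id)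
      (tendsto_id.mono_left (nhdsWithin_mono _ fun x hx => ne_of_gt hx)) ?_
    filter_upwards [h1, h2.eventually hM, self_mem_nhdsWithin] with t ht1 ht2 (ht : 0 < t)
    refine ht2.2 ?_
    have h3 : ρ p ≤ 0 := hM.self_of_nhds.1 hp
    rw [smul_eq_mul, inv_mul_lt_iff₀ ht, mul_zero] at ht1
    linarith
  refine ⟨?_, subset_closure hp⟩
  have htop : Submodule.span ℝ (tangentConeAt ℝ M p) = ⊤ := by
    obtain ⟨v, hv⟩ : ∃ v, fderiv ℝ ρ p v ≠ 0 := by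
      by_contra! h
      exact hρ0 (ContinuousLinearMap.ext h)
    obtain ⟨v₀, hv₀⟩ : ∃ v, fderiv ℝ ρ p v < 0 := by
      rcases hv.lt_or_gt with h | h
      · exact ⟨v, h⟩
      · exact ⟨-v, by rw [map_neg]; linarith⟩
    have h0 := Submodule.subset_span (R := ℝ) (hcone v₀ hv₀)
    refine eq_top_iff.2 fun w _ => ?_
    -- Chosen so that the derivative of `ρ` along `w + k v₀` is at most `-1`. Thus `w` is a
    -- combination of two vectors pointing strictly into `M`.
    set k := (|fderiv ℝ ρ p w| + 1) / -fderiv ℝ ρ p v₀ with hk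
    have hkv : k * fderiv ℝ ρ p v₀ = -(|fderiv ℝ ρ p w| + 1) := by
      have := hv₀.ne
      rw [hk, div_neg, neg_mul, div_mul_cancel₀ _ this]
    have h1 : w + k • v₀ ∈ tangentConeAt ℝ M p := by
      refine hcone _ ?_
      rw [map_add, map_smul, smul_eq_mul, hkv]
      linarith [le_abs_self (fderiv ℝ ρ p w)]
    have h2 := Submodule.sub_mem _ (Submodule.subset_span (R := ℝ) h1)
      (Submodule.smul_mem _ k h0)
    simpa using h2
  rw [htop]
  exact dense_univ

/-- Unique differentiability at boundary points other than corners lets `fderivWithin` there be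
computed as a limit of interior derivatives. -/
theorem IsPiecewiseSmoothDomain.exists_finite_uniqueDiffWithinAt {M : Set ℂ}
    (hM : IsPiecewiseSmoothDomain M) :
    ∃ C : Set ℂ, C.Finite ∧ ∀ p ∈ M \ C, UniqueDiffWithinAt ℝ M p := by
  obtain ⟨C, hC, h⟩ := hM.smooth_boundary
  refine ⟨C, hC, fun p hp => ?_⟩
  by_cases hpi : p ∈ interior M
  · exact uniqueDiffWithinAt_of_mem_nhds (mem_interior_iff_mem_nhds.1 hpi)
  · obtain ⟨W, ρ, hW, hpW, hρ, hρ0, hWM⟩ := h p ⟨⟨subset_closure hp.1, hpi⟩, hp.2⟩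
    exact uniqueDiffWithinAt_of_sublevel hp.1
      ((hρ.contDiffAt (hW.mem_nhds hpW)).differentiableAt (by simp)) hρ0
      (by filter_upwards [hW.mem_nhds hpW] with z hz using hWM z hz)

/-- A minimizer has no interior open set on which `f_z` vanishes, if `V'` takes values
below `-1`. -/
theorem IsMinimizer.not_eventually_wirt_eq_zero {V : ℝ → ℝ} (hV : IsAdmissible V) {M : Set ℂ}
    (hM : IsCompact M) {f : ℂ → ℂ} (hf : IsMinimizer V M f) {x : ℝ} (hx : 0 < x)
    (hVx : 1 + deriv V x < 0) {z : ℂ} (hz : z ∈ interior M) :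
    ¬ ∀ᶠ w in 𝓝 z, wirt f w = 0 := by
  intro h0
  obtain ⟨χ, hχW, h'χ, hχ, -, hχz⟩ := exists_contDiff_tsupport_subset (n := ⊤)
    (inter_mem h0 (isOpen_interior.mem_nhds hz))
  have hh : ContDiff ℝ ∞ (fun w => (χ w : ℂ)) := Complex.ofRealCLM.contDiff.comp hχ
  have h'h : HasCompactSupport (fun w => (χ w : ℂ)) :=
    h'χ.comp_left (g := Complex.ofReal) rfl
  have hsupp : tsupport (fun w => (χ w : ℂ)) ⊆ tsupport χ := by
    refine closure_mono fun z hz => ?_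
    simpa using hz
  set h : ℂ → ℂ := fun w => (χ w : ℂ) with hdef
  have hvar : IsVariation (interior M) h :=
    ⟨hh, h'h, hsupp.trans (hχW.trans inter_subset_right)⟩
  obtain ⟨D, hD⟩ := hh.lipschitzWith_of_hasCompactSupport h'h (by simp)
  -- This gives `|t h_z|² ≤ x`, where monotonicity of `V'` keeps `1 + V'` negative. So the bump
  -- lowers the potential wherever `h_z ≠ 0`; minimality forces `h_z = 0` almost everywhere, hence
  -- `h = 0`, against `χ z = 1`.
  set t : ℝ := √x / (D + 1) with ht
  have hD1 : (0 : ℝ) < D + 1 := by positivity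
  have htpos : 0 < t := div_pos (Real.sqrt_pos.2 hx) hD1
  have hlt : ∀ b : ℂ, ‖b‖ ≤ D → b ≠ 0 → potential V (t * b) < potential V 0 := by
    intro b hb hb0
    have hne : (t : ℂ) * b ≠ 0 := mul_ne_zero (Complex.ofReal_ne_zero.2 htpos.ne') hb0
    refine hV.potential_lt_zero hne ?_
    have h1 : ‖(t : ℂ) * b‖ ^ 2 ≤ x := by
      rw [norm_mul, Complex.norm_real, Real.norm_of_nonneg htpos.le, ← Real.sq_sqrt hx.le]
      have : t * ‖b‖ ≤ √x := by
        rw [ht, div_mul_eq_mul_div, div_le_iff₀ hD1]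
        gcongr
        linarith
      gcongr
    have h2 := hV.deriv_mono (x := ‖(t : ℂ) * b‖ ^ 2)
      (by have := norm_pos_iff.2 hne; positivity) h1
    linarith
  have hbound : ∀ w, ‖wirt h w‖ ≤ D := fun w =>
    (norm_wirt_le _ _).trans (norm_fderiv_le_of_lipschitz ℝ hD)
  have hle : ∀ w, potential V (wirt f w + t * wirt h w) ≤ potential V (wirt f w) ∧
      (potential V (wirt f w + t * wirt h w) = potential V (wirt f w) → wirt h w = 0) := by
    intro w
    by_cases hw : w ∈ tsupport h
    · rw [show wirt f w = 0 from (hχW (hsupp hw)).1, zero_add]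
      by_cases hb : wirt h w = 0
      · simp [hb]
      · have := hlt _ (hbound w) hb
        exact ⟨this.le, fun h => absurd h this.ne⟩
    · simp [wirt_eq_zero_of_fderiv (fderiv_eq_zero_of_notMem_tsupport hw)]
  have hmin : energy V M f ≤ energyAlong V M f h t :=
    hf.2 _ (almostSmooth_add_mul hf.1 hh h'h t) (eqOn_frontier_add_mul hvar.2.2 t)
  rw [hV.energyAlong_eq hM hf.1 hvar] at hmin
  obtain ⟨⟨C, hC⟩, -⟩ := hf.1
  have hi := hV.integrable_potential_wirt hM hC
  have hi' : Integrable (fun w => potential V (wirt f w + t * wirt h w))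
      (volume.restrict (interior M)) :=
    (hV.integrable_potential_wirt hM (lipschitzOnWith_add_mul hC hD t)).congr (by
      filter_upwards [wirt_add_mul_ae hC (hh.differentiable (by simp)) t] with z hz
      rw [hz])
  have hint : ∫ w in interior M, (potential V (wirt f w) -
      potential V (wirt f w + t * wirt h w)) = 0 := by
    refine le_antisymm ?_ (integral_nonneg fun w => sub_nonneg.2 (hle w).1)
    rw [integral_sub hi hi']
    linarith
  have hae := (integral_eq_zero_iff_of_nonneg (fun w => sub_nonneg.2 (hle w).1)
    (hi.sub' hi')).1 hint
  have hzero : ∀ᵐ w, wirt h w = 0 := by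
    have h1 := (ae_restrict_iff' isOpen_interior.measurableSet).1 hae
    filter_upwards [h1] with w hw
    by_cases hwM : w ∈ interior M
    · exact (hle w).2 (sub_eq_zero.1 (hw hwM)).symm
    · exact wirt_eq_zero_of_fderiv
        (fderiv_eq_zero_of_notMem_tsupport fun h => hwM (hvar.2.2 h))
  have := eq_zero_of_wirt_ae_eq_zero hD h'h hzero z
  simp [hdef, hχz] at this

/-- If `V'` takes values below `-1`, then the derivative `f_z` of a minimizer is bounded away from
zero at the interior points where it is smooth. -/
theorem IsMinimizer.le_norm_sq_wirt {V : ℝ → ℝ} (hV : IsAdmissible V) {M : Set ℂ}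
    (hM : IsCompact M) {f : ℂ → ℂ} (hf : IsMinimizer V M f) {x : ℝ} (hx : 0 < x)
    (hVx : 1 + deriv V x < 0) {P : Set ℂ} (hP : P.Finite) (hfP : ContDiffOn ℝ ∞ f (M \ P)) {z : ℂ}
    (hz : z ∈ interior M \ P) : x ≤ ‖wirt f z‖ ^ 2 := by
  have hor : ∀ w ∈ interior M \ P, wirt f w = 0 ∨ x ≤ ‖wirt f w‖ ^ 2 := by
    intro w hw
    by_cases h0 : wirt f w = 0
    · exact Or.inl h0
    · refine Or.inr (le_of_not_gt fun hlt => ?_)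
      have hreg : w ∈ reg M f ∩ interior M :=
        ⟨⟨interior_subset hw.1, contDiffWithinAt_of_notMem_finite hP hfP (interior_subset hw.1)
          hw.2, by rwa [dz_eq_wirt hw.1]⟩, hw.1⟩
      have h1 := hf.isStable hV hM w hreg
      rw [dz_eq_wirt hw.1] at h1
      have h2 := hV.deriv_mono (x := ‖wirt f w‖ ^ 2)
        (by have := norm_pos_iff.2 h0; positivity) hlt.le
      linarith
  refine (hor z hz).resolve_left fun h0 => ?_
  refine hf.not_eventually_wirt_eq_zero hV hM hx hVx hz.1 ?_
  have hsm : ContDiffAt ℝ ∞ f z :=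
    (contDiffWithinAt_of_notMem_finite hP hfP (interior_subset hz.1) hz.2).contDiffAt
      (mem_interior_iff_mem_nhds.1 hz.1)
  have hc : ContinuousAt (fun w => ‖wirt f w‖ ^ 2) z := (contDiffAt_wirt hsm).continuousAt.norm.pow 2
  have hlt : ‖wirt f z‖ ^ 2 < x := by simpa [h0] using hx
  -- Near a zero of `f_z` continuity gives `|f_z|² < x`, and the dichotomy `hor` then leaves only
  -- `f_z = 0`.
  filter_upwards [hc.eventually (gt_mem_nhds hlt),
    (isOpen_interior.sdiff hP.isClosed).mem_nhds hz] with w hw1 hw2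
  exact (hor w hw2).resolve_right (not_le.2 hw1)

/-- The uniform bound `|f_z|² ≥ x` at smooth interior points survives in the limit at boundary
points, `M` being the closure of its interior. Exceptions are confined to the singular points of `f`
and the corners. -/
theorem IsMinimizer.almostImmersed {V : ℝ → ℝ} (hV : IsAdmissible V) {M : Set ℂ}
    (hM : IsPiecewiseSmoothDomain M) {f : ℂ → ℂ} (hf : IsMinimizer V M f)
    (hx : ∃ x : ℝ, 0 < x ∧ 1 + deriv V x < 0) : AlmostImmersed M f := by
  obtain ⟨x, hx, hVx⟩ := hx
  obtain ⟨C, hC, hCM⟩ := hM.exists_finite_uniqueDiffWithinAt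
  refine ⟨hf.1.1, ?_⟩
  obtain ⟨P, hP, hfP⟩ := hf.1.2
  refine (hP.union hC).subset fun z hz => ?_
  by_contra hcon
  rw [mem_union, not_or] at hcon
  have hsm := contDiffWithinAt_of_notMem_finite hP hfP hz.1 hcon.1
  refine hz.2 ⟨hz.1, hsm, ?_⟩
  -- Order one, written as a successor, supplies a derivative `f'` of `f` within `M` continuous at
  -- `z`. It is the ordinary derivative at nearby interior points, and at `z` unique
  -- differentiability identifies it with the one in `dz`.
  have h1 : ContDiffWithinAt ℝ (0 + 1) f M z := hsm.of_le (by simp)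
  obtain ⟨u, hu, huM, -, f', hf', hcont⟩ :=
    (contDiffWithinAt_succ_iff_hasFDerivWithinAt' (by simp)).1 h1
  rw [insert_eq_of_mem hz.1] at hu huM
  have hdz : dz M f z = (f' z 1 - Complex.I * f' z Complex.I) / 2 := by
    rw [dz, (hf' z (mem_of_mem_nhdsWithin hz.1 hu)).fderivWithin (hCM z ⟨hz.1, hcon.2⟩)]
  have hlim : Tendsto (fun w => ‖(f' w 1 - Complex.I * f' w Complex.I) / 2‖ ^ 2)
      (𝓝[interior M] z) (𝓝 (‖dz M f z‖ ^ 2)) := by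
    rw [hdz]
    have h2 : Tendsto f' (𝓝[interior M] z) (𝓝 (f' z)) :=
      hcont.continuousWithinAt.mono interior_subset
    have hev : ∀ v : ℂ, Tendsto (fun w => f' w v) (𝓝[interior M] z) (𝓝 (f' z v)) := fun v =>
      ((ContinuousLinearMap.apply ℝ ℂ v).continuous.tendsto (f' z)).comp h2
    exact (((hev 1).sub ((hev Complex.I).const_mul _)).div_const _).norm.pow 2
  have hne : (𝓝[interior M] z).NeBot := by
    rw [← mem_closure_iff_nhdsWithin_neBot, hM.closure_interior]
    exact hz.1
  have hle : x ≤ ‖dz M f z‖ ^ 2 := by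
    refine ge_of_tendsto hlim ?_
    filter_upwards [nhdsWithin_mono z interior_subset hu, self_mem_nhdsWithin,
      mem_nhdsWithin_of_mem_nhds (hP.isClosed.isOpen_compl.mem_nhds hcon.1)] with w hwu hwM hwP
    have h3 := hf.le_norm_sq_wirt hV hM.isCompact hx hVx hP hfP ⟨hwM, hwP⟩
    have h4 := ((hf' w hwu).hasFDerivAt (mem_interior_iff_mem_nhds.1 hwM)).fderiv
    rwa [wirt, h4] at h3
  intro h0
  rw [h0] at hle
  simp at hle
  linarith

end PlanarElasticity

end

/-! ### The three assertions combined -/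

theorem mainTheorem6 (V : ℝ → ℝ) (hV : IsAdmissible V) (M : Set ℂ)
    (hM : IsPiecewiseSmoothDomain M) (f : ℂ → ℂ) (hf : AlmostSmooth M f) :
    (AlmostImmersed M f ∨ (∃ x : ℝ, 0 < x ∧ 1 + deriv V x < 0) →
      (IsMinimizer V M f ↔ IsWeakCriticalPoint V M f ∧ IsStable V M f)) ∧
    (IsWeakCriticalPoint V M f → IsStable V M f →
      (∃ z ∈ reg M f ∩ interior M, 1 + deriv V (‖dz M f z‖ ^ 2) ≠ 0) →
      IsStrictMinimizer V M f) ∧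
    (IsWeakCriticalPoint V M f → ¬ IsMinimizer V M f →
      IsLocallyUnstable V M f ∧ HasLocallyNegativeSecondVariation V M f) := by
  have hMc := hM.isCompact
  refine ⟨fun hor => ⟨fun hmin => ⟨⟨?_, fun h hh => hmin.hasDerivAt_zero hV hMc hh⟩,
    hmin.isStable hV hMc⟩, fun h => h.1.isMinimizer hV hMc hf h.2⟩,
    fun hcrit hS hne => hcrit.isStrictMinimizer hV hM hf hS hne, fun hcrit hmin => ?_⟩
  · exact hor.elim id fun hx => hmin.almostImmersed hV hM hx
  · have hS : ¬ IsStable V M f := fun hS => hmin (hcrit.isMinimizer hV hMc hf hS)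
    simp only [IsStable, not_forall, not_le] at hS
    obtain ⟨p, hp, hneg⟩ := hS
    refine ⟨⟨hf, p, hp.2, fun U hU => ?_⟩, p, hp.2, fun U hU => ?_⟩
    · obtain ⟨h, hh, -, hlt⟩ := hV.exists_variation_lt hMc hf hcrit.2 hp hneg hU
      exact ⟨h, ⟨hh.1, hh.2.1,
        hh.2.2.trans (Set.inter_subset_inter_right U Set.inter_subset_right)⟩, hlt⟩
    · obtain ⟨h, hh, hneg', -⟩ := hV.exists_variation_lt hMc hf hcrit.2 hp hneg hU
      exact ⟨h, hh, hneg'⟩
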